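/- Let $\gamma\in\mathbb R$, $N\in\mathbb Z_{\ge 0}$, $\mu\in\mathbb C$ and $\epsilon\in\{+,-\}$. **Function spaces.** $S_n$ acts on $\mathbb R^n$ by permuting coordinates, $(w\boldsymbol x)_i=x_{w^{-1}(i)}$, and on functions by $(wf)(\boldsymbol x)=f(w^{-1}\boldsymbol x)$. Let $\mathbb R^n_+=\{\boldsymbol x: x_1>\dots>x_n\}$. Let $\mathscr C^\infty(\mathbb R^n)$ be the space of smooth functions $\mathbb R^n\to\mathbb C$, and let $\mathscr{CB}^\infty(\mathbb R^n)$ be the space of continuous functions $f:\mathbb R^n\to\mathbb C$ such that $f|_{w\mathbb R^n_+}$ is smooth for every $w\in S_n$. **Propagation operator.** For $1\le j\neq k\le n$ and continuous $f:\mathbb R^n\to\mathbb C$ put $$(I_{jk}f)(\boldsymbol x)=\int_0^{x_j-x_k} f\bigl(\boldsymbol x-y(\boldsymbol e_j-\boldsymbol e_k)\bigr)\,dy ,$$ and $s_j^\gamma=s_j+\gamma I_{j\,j+1}$ for $1\le j\le n-1$, where $s_j$ is the transposition of $j$ and $j+1$. For $w=s_{i_1}\cdots s_{i_l}\in S_n$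 put $w^\gamma=s_{i_1}^\gamma\cdots s_{i_l}^\gamma$ (this does not depend on the decomposition). For $f\in\mathscr C^\infty(\mathbb R^n)$ the function $P^\gamma_{(n)}f$ is the continuous function on $\mathbb R^n$ with $$P^\gamma_{(n)}f=w^{-1}w^\gamma f\quad\text{on } w^{-1}\mathbb R^n_+\qquad(w\in S_n).$$ **Creation operators.** Let $\boldsymbol i=(i_1,\dots,i_n)$ be a tuple of distinct elements of $\{1,\dots,N\}$. For $f:\mathbb R^N\to\mathbb C$ continuous and $\boldsymbol x\in\mathbb R^{N+1}$ let $f^{\pm}_{\boldsymbol i,\boldsymbol y}(\boldsymbol x)$ be the value of $f$ at the point obtained from $(x_2,\dots,x_{N+1})$ (sign $+$) or $(x_1,\dots,x_N)$ (sign $-$) by replacing the $i_m$-th coordinate by $y_m$ for $m=1,\dots,n$. Then $$(\hat e^+_{\mu;\boldsymbol i}f)(\boldsymbol x)=e^{i\mu x_1}\Bigl(\prod_{m=1}^n\int_{x_{i_{m+1}+1}}^{x_{i_m+1}}dy_m\,e^{i\mu(x_{i_m+1}-y_m)}\Bigr)f^+_{\boldsymbol i,\boldsymbol y}(\boldsymbol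 x)\quad\text{if } x_{i_1+1}>\dots>x_{i_n+1}>x_1,$$ with the convention $i_{n+1}+1:=1$, $$(\hat e^-_{\mu;\boldsymbol i}f)(\boldsymbol x)=e^{i\mu x_{N+1}}\Bigl(\prod_{m=1}^n\int_{x_{i_m}}^{x_{i_{m-1}}}dy_m\,e^{i\mu(x_{i_m}-y_m)}\Bigr)f^-_{\boldsymbol i,\boldsymbol y}(\boldsymbol x)\quad\text{if } x_{N+1}>x_{i_1}>\dots>x_{i_n},$$ with the convention $i_0:=N+1$, and both are $0$ at all other $\boldsymbol x$. In particular, for the empty tuple, $(\hat e^+_{\mu;\emptyset}f)(\boldsymbol x)=e^{i\mu x_1}f(x_2,\dots,x_{N+1})$ and $(\hat e^-_{\mu;\emptyset}f)(\boldsymbol x)=e^{i\mu x_{N+1}}f(x_1,\dots,x_N)$. Put $$b^\epsilon_\mu=\sum_{n=0}^N\gamma^n\sum_{\boldsymbol i}\hat e^\epsilon_{\mu;\boldsymbol i},$$ the inner sum running over all $n$-tuples $\boldsymbol i$ of distinct elements of $\{1,\dots,N\}$. **Theorem.** The operator $\hat e^\epsilon_{\mu;\emptyset}$ maps $\mathscr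 C^\infty(\mathbb R^N)$ to $\mathscr C^\infty(\mathbb R^{N+1})$, the operator $P^\gamma_{(N)}$ maps $\mathscr C^\infty(\mathbb R^N)$ to $\mathscr{CB}^\infty(\mathbb R^N)$, and $$P^\gamma_{(N+1)}\,\hat e^\epsilon_{\mu;\emptyset}=b^\epsilon_\mu\,P^\gamma_{(N)}$$ as linear maps from $\mathscr C^\infty(\mathbb R^N)$ to $\mathscr{CB}^\infty(\mathbb R^{N+1})$. -/

import Mathlib

open scoped ContDiff

noncomputable section

namespace QNLS

/-! Everything is indexed from `0`: a label `j ∈ {1, …, n}` of the usual notation is `j - 1 : Fin n`. -/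

/-- The action of `S_n` on `ℝⁿ` by permutation of coordinates: `(w x)_i = x_{w⁻¹(i)}`. -/
def permAct {n : ℕ} (w : Equiv.Perm (Fin n)) (x : Fin n → ℝ) : Fin n → ℝ :=
  fun i => x (w⁻¹ i)

/-- The fundamental alcove `ℝⁿ₊ = {x | x₁ > … > xₙ}`. -/
def fundAlcove (n : ℕ) : Set (Fin n → ℝ) := {x | StrictAnti x}

/-- The alcove `w ℝⁿ₊`. -/
def alcove {n : ℕ} (w : Equiv.Perm (Fin n)) : Set (Fin n → ℝ) :=
  permAct w '' fundAlcove n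

/-- The space `C^∞(ℝⁿ)` of smooth complex-valued functions. -/
def smoothFun (n : ℕ) : Submodule ℂ ((Fin n → ℝ) → ℂ) where
  carrier := {f | ContDiff ℝ ∞ f}
  zero_mem' := (contDiff_const : ContDiff ℝ ∞ fun _ : Fin n → ℝ => (0 : ℂ))
  add_mem' {f g} (hf : ContDiff ℝ ∞ f) (hg : ContDiff ℝ ∞ g) := hf.add hg
  smul_mem' c f (hf : ContDiff ℝ ∞ f) := hf.const_smul c

/-- The space `CB^∞(ℝⁿ)` of continuous functions on `ℝⁿ` that are smooth on every alcove. -/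
def cbFun (n : ℕ) : Submodule ℂ ((Fin n → ℝ) → ℂ) where
  carrier := {f | Continuous f ∧ ∀ w : Equiv.Perm (Fin n), ContDiffOn ℝ ∞ f (alcove w)}
  zero_mem' := ⟨continuous_const, fun _ => contDiffOn_const⟩
  add_mem' hf hg := ⟨hf.1.add hg.1, fun w => (hf.2 w).add (hg.2 w)⟩
  smul_mem' c _ hf := ⟨hf.1.const_smul c, fun w => ContDiffOn.const_smul c (hf.2 w)⟩

/-! ### The integral representation -/

/-- `(I_{jk} f)(x) = ∫_0^{x_j - x_k} f(x - y (e_j - e_k)) dy`. -/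
def integralOp {n : ℕ} (j k : Fin n) (f : (Fin n → ℝ) → ℂ) (x : Fin n → ℝ) : ℂ :=
  ∫ y in (0 : ℝ)..(x j - x k),
    f (x - y • ((Pi.single j 1 : Fin n → ℝ) - (Pi.single k 1 : Fin n → ℝ)))

/-- The labels of the simple transpositions of `S_n`. -/
abbrev SimpleIndex (n : ℕ) : Type := {j : ℕ // j + 1 < n}

/-- The smaller of the two neighbouring labels interchanged by a simple transposition. -/
def SimpleIndex.fst {n : ℕ} (j : SimpleIndex n) : Fin n := ⟨j.1, Nat.lt_of_succ_lt j.2⟩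

/-- The larger of the two labels interchanged by a simple transposition. -/
def SimpleIndex.snd {n : ℕ} (j : SimpleIndex n) : Fin n := ⟨j.1 + 1, j.2⟩

/-- The simple transposition `s_j`. -/
def simpleSwap {n : ℕ} (j : SimpleIndex n) : Equiv.Perm (Fin n) :=
  Equiv.swap j.fst j.snd

/-- The integral-reflection operator `s_j^γ = s_j + γ I_{j, j+1}`, with `(w f)(x) = f(w⁻¹ x)`. -/
def integralReflection {n : ℕ} (γ : ℝ) (j : SimpleIndex n) (f : (Fin n → ℝ) → ℂ)
    (x : Fin n → ℝ) : ℂ :=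
  f (permAct (simpleSwap j)⁻¹ x) + (γ : ℂ) * integralOp j.fst j.snd f x

/-- The composition `s_{i₁}^γ ⋯ s_{i_l}^γ` along a word `[i₁, …, i_l]`. -/
def wordOp {n : ℕ} (γ : ℝ) (l : List (SimpleIndex n)) (f : (Fin n → ℝ) → ℂ) :
    (Fin n → ℝ) → ℂ :=
  l.foldr (fun j g => integralReflection γ j g) f

/-- Every permutation is a product of simple transpositions. -/
theorem exists_word {n : ℕ} (w : Equiv.Perm (Fin n)) :
    ∃ l : List (SimpleIndex n), (l.map simpleSwap).prod = w := by
  cases n with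
  | zero => exact ⟨[], Subsingleton.elim _ _⟩
  | succ n =>
    have hw : w ∈ Submonoid.closure
        (Set.range fun i : Fin n => Equiv.swap i.castSucc i.succ) := by
      rw [Equiv.Perm.mclosure_swap_castSucc_succ]; trivial
    induction hw using Submonoid.closure_induction with
    | mem x hx =>
      obtain ⟨i, rfl⟩ := hx
      exact ⟨[⟨i.1, Nat.succ_lt_succ i.2⟩], by simp [simpleSwap]; rfl⟩
    | one => exact ⟨[], rfl⟩
    | mul x y _ _ hx hy =>
      obtain ⟨l, rfl⟩ := hx
      obtain ⟨l', rfl⟩ := hy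
      exact ⟨l ++ l', by simp⟩

/-- `w^γ = s_{i₁}^γ ⋯ s_{i_l}^γ` for a decomposition `w = s_{i₁} ⋯ s_{i_l}` into simple
transpositions. The `s_j^γ` satisfy the relations of the `s_j` on continuous functions, so on these
the operator is the same for every decomposition; one decomposition is picked here. -/
def permOp {n : ℕ} (γ : ℝ) (w : Equiv.Perm (Fin n)) (f : (Fin n → ℝ) → ℂ) :
    (Fin n → ℝ) → ℂ :=
  wordOp γ (exists_word w).choose f

/-! ### The propagation operator -/

/-- A permutation `w` such that the coordinates of `w x` are weakly decreasing. -/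
def sortPerm {n : ℕ} (x : Fin n → ℝ) : Equiv.Perm (Fin n) :=
  (Tuple.sort fun i => -x i)⁻¹

theorem antitone_sortPerm {n : ℕ} (x : Fin n → ℝ) : Antitone (permAct (sortPerm x) x) := by
  intro i j hij
  have h := Tuple.monotone_sort (fun i => -x i) hij
  simpa [permAct, sortPerm] using h

/-- At a regular vector, `sortPerm x` is the only `w` with `x ∈ w⁻¹ ℝⁿ₊`. -/
theorem sortPerm_eq {n : ℕ} {w : Equiv.Perm (Fin n)} {x : Fin n → ℝ} (hx : x ∈ alcove w⁻¹) :
    sortPerm x = w := by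
  obtain ⟨z, hz, rfl⟩ := hx
  have hz' : StrictAnti z := hz
  have h := antitone_sortPerm (permAct w⁻¹ z)
  set σ := sortPerm (permAct w⁻¹ z) with hσ
  have hmono : Monotone fun i => (w * σ⁻¹) i := by
    intro i j hij
    have h1 := h hij
    simp only [permAct, inv_inv] at h1
    simpa using (hz'.le_iff_ge.1 h1)
  have hone : w * σ⁻¹ = 1 := by
    have hs : StrictMono fun i => (w * σ⁻¹) i := hmono.strictMono_of_injective (w * σ⁻¹).injective
    have : (OrderIso.refl (Fin n)) =
        hs.orderIsoOfSurjective _ (w * σ⁻¹).surjective := Subsingleton.elim _ _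
    ext i
    have h2 := congrArg (fun e : Fin n ≃o Fin n => e i) this
    exact congrArg Fin.val h2.symm
  exact (mul_inv_eq_one.1 hone).symm

/-- The propagation operator `P^γ_{(n)}`: `P^γ_{(n)} f = w⁻¹ w^γ f` on `w⁻¹ ℝⁿ₊`, where
`(w⁻¹ g)(x) = g(w x)`. The same formula is used on the closure of `w⁻¹ ℝⁿ₊`; for continuous `f` the
values on different closed alcoves agree where these meet, and this is the continuous extension. -/
def propagation {n : ℕ} (γ : ℝ) (f : (Fin n → ℝ) → ℂ) (x : Fin n → ℝ) : ℂ :=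
  permOp γ (sortPerm x) f (permAct (sortPerm x) x)

theorem propagation_eq {n : ℕ} (γ : ℝ) (f : (Fin n → ℝ) → ℂ) {w : Equiv.Perm (Fin n)}
    {x : Fin n → ℝ} (hx : x ∈ alcove w⁻¹) :
    propagation γ f x = permOp γ w f (permAct w x) := by
  rw [propagation, sortPerm_eq hx]

/-! ### The non-symmetric creation operators -/

/-- The sign `ε = ±`. -/
inductive Sgn : Type
  | plus : Sgn
  | minus : Sgn

/-- The label in `{1, …, N+1}` of the added particle: `1` for `ε = +` and `N+1` for `ε = -`. -/
def newLabel (N : ℕ) : Sgn → Fin (N + 1)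
  | .plus => 0
  | .minus => Fin.last N

/-- The relabelling `j ↦ j^ε` from `{1, …, N}` to `{1, …, N+1}`: `j⁺ = j + 1` and `j⁻ = j`. -/
def shiftLabel {N : ℕ} : Sgn → Fin N → Fin (N + 1)
  | .plus => Fin.succ
  | .minus => Fin.castSucc

/-- The chain of labels `(i₁⁺, …, iₙ⁺, 1)` for `ε = +` and `(N+1, i₁⁻, …, iₙ⁻)` for `ε = -`. -/
def chain {N n : ℕ} : Sgn → (Fin n → Fin N) → Fin (n + 1) → Fin (N + 1)
  | .plus, i => Fin.snoc (α := fun _ => Fin (N + 1)) (fun m => shiftLabel .plus (i m))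
      (newLabel N .plus)
  | .minus, i => Fin.cons (α := fun _ => Fin (N + 1)) (newLabel N .minus)
      (fun m => shiftLabel .minus (i m))

open Classical in
/-- The step operator `θ_{t₁ t₂ ⋯ t_p}`: multiplication by the indicator function of
`x_{t₁} > x_{t₂} > ⋯ > x_{t_p}`. -/
def stepOp {M p : ℕ} (t : Fin p → Fin M) (g : (Fin M → ℝ) → ℂ) (x : Fin M → ℝ) : ℂ :=
  if StrictAnti (fun m => x (t m)) then g x else 0

/-- The iterated integral `∫_{a₁}^{b₁} dy₁ ⋯ ∫_{aₙ}^{bₙ} dyₙ F(y₁, …, yₙ)`. -/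
def iterIntegral : (n : ℕ) → (a b : Fin n → ℝ) → ((Fin n → ℝ) → ℂ) → ℂ
  | 0, _, _, F => F Fin.elim0
  | n + 1, a, b, F => ∫ y in (a 0)..(b 0),
      iterIntegral n (Fin.tail a) (Fin.tail b)
        (fun ys => F (Fin.cons (α := fun _ => ℝ) y ys))

/-- `(φ̂^ε f)(x)`: evaluation of `f` at `x ∈ ℝ^{N+1}` with the coordinate of the added particle
omitted. -/
def hatPhi {N : ℕ} (ε : Sgn) (f : (Fin N → ℝ) → ℂ) (x : Fin (N + 1) → ℝ) : ℂ :=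
  f (fun k => x (shiftLabel ε k))

/-- `(φ̄_i(y) f)(x)`: evaluation of `f` at `x` with the coordinate `x_{i_m}` replaced by `y_m` for
every `m`. -/
def barPhi {N n : ℕ} (i : Fin n ↪ Fin N) (y : Fin n → ℝ) (f : (Fin N → ℝ) → ℂ)
    (x : Fin N → ℝ) : ℂ :=
  f (Function.extend i y x)

/-- The elementary creation operators `ê^ε_{μ;i}`, for a tuple `i = (i₁, …, iₙ)` of distinct labels
in `{1, …, N}`. With `(t₀, …, tₙ) = chain ε i`,
`(ê^ε_{μ;i} f)(x)` is `e^{iμ x_{new}} θ_{t₀ ⋯ tₙ}(x)` times the integral over `y_m` from `x_{t_m}`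
to `x_{t_{m-1}}` (`1 ≤ m ≤ n`) of `∏ₘ e^{iμ (x_{i_m^ε} - y_m)} (φ̂^ε φ̄_i(y) f)(x)`. -/
def elemCreation {N n : ℕ} (ε : Sgn) (μ : ℂ) (i : Fin n ↪ Fin N) (f : (Fin N → ℝ) → ℂ) :
    (Fin (N + 1) → ℝ) → ℂ :=
  stepOp (chain ε i) fun x =>
    Complex.exp (Complex.I * μ * (x (newLabel N ε) : ℂ)) *
      iterIntegral n (fun m => x (chain ε i m.succ)) (fun m => x (chain ε i m.castSucc))
        (fun y => (∏ m : Fin n,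
            Complex.exp (Complex.I * μ * ((x (shiftLabel ε (i m)) : ℂ) - (y m : ℂ)))) *
          hatPhi ε (barPhi i y f) x)

/-- `ê^ε_{μ;∅}`, the operator `ê^ε_{μ;i}` for the tuple of length `n = 0`. -/
def emptyCreation {N : ℕ} (ε : Sgn) (μ : ℂ) (f : (Fin N → ℝ) → ℂ) : (Fin (N + 1) → ℝ) → ℂ :=
  elemCreation ε μ (Function.Embedding.ofIsEmpty : Fin 0 ↪ Fin N) f

theorem emptyCreation_plus {N : ℕ} (μ : ℂ) (f : (Fin N → ℝ) → ℂ) (x : Fin (N + 1) → ℝ) :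
    emptyCreation .plus μ f x =
      Complex.exp (Complex.I * μ * (x 0 : ℂ)) * f (fun k => x k.succ) := by
  have hs : StrictAnti fun m : Fin (0 + 1) =>
      x (chain .plus (Function.Embedding.ofIsEmpty : Fin 0 ↪ Fin N) m) := by
    intro a b hab; have ha := a.2; have hb := b.2; have h : a.1 < b.1 := hab; omega
  have he : ∀ (y : Fin 0 → ℝ) (z : Fin N → ℝ),
      Function.extend (Function.Embedding.ofIsEmpty : Fin 0 ↪ Fin N) y z = z := by
    intro y z; funext k; exact Function.extend_apply' _ _ _ (by rintro ⟨a, -⟩; exact a.elim0)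
  simp [emptyCreation, elemCreation, stepOp, hs, iterIntegral, hatPhi, barPhi, he, newLabel,
    shiftLabel]

theorem emptyCreation_minus {N : ℕ} (μ : ℂ) (f : (Fin N → ℝ) → ℂ) (x : Fin (N + 1) → ℝ) :
    emptyCreation .minus μ f x =
      Complex.exp (Complex.I * μ * (x (Fin.last N) : ℂ)) * f (fun k => x k.castSucc) := by
  have hs : StrictAnti fun m : Fin (0 + 1) =>
      x (chain .minus (Function.Embedding.ofIsEmpty : Fin 0 ↪ Fin N) m) := by
    intro a b hab; have ha := a.2; have hb := b.2; have h : a.1 < b.1 := hab; omega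
  have he : ∀ (y : Fin 0 → ℝ) (z : Fin N → ℝ),
      Function.extend (Function.Embedding.ofIsEmpty : Fin 0 ↪ Fin N) y z = z := by
    intro y z; funext k; exact Function.extend_apply' _ _ _ (by rintro ⟨a, -⟩; exact a.elim0)
  simp [emptyCreation, elemCreation, stepOp, hs, iterIntegral, hatPhi, barPhi, he, newLabel,
    shiftLabel]

/-- The non-symmetric creation operator
`b^ε_μ = ∑_{n=0}^N γⁿ ∑_i ê^ε_{μ;i}`, the inner sum running over all `n`-tuples `i` of distinct
labels in `{1, …, N}`. -/
def creation {N : ℕ} (γ : ℝ) (ε : Sgn) (μ : ℂ) (f : (Fin N → ℝ) → ℂ)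
    (x : Fin (N + 1) → ℝ) : ℂ :=
  ∑ n ∈ Finset.range (N + 1), (γ : ℂ) ^ n * ∑ i : Fin n ↪ Fin N, elemCreation ε μ i f x

end QNLS

end

open QNLS

open scoped ContDiff

noncomputable section

namespace QNLS

/-! ### Smoothness of integrals depending on a parameter -/

section ParametricIntegral

universe u

variable {H E : Type u} [NormedAddCommGroup H] [NormedSpace ℝ H] [ProperSpace H]
  [NormedAddCommGroup E] [NormedSpace ℝ E]

/-! Both sides solve the same integral equation in the coordinate of the added particle, and that
equation has only one solution. At `x` it says that `F x` is `e^{iμ x_new}` times `P^γ_{(N)} f` of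
the old coordinates, plus `γ` times the sum over `k` of the integrals of `e^{iμ(x_new - y)} F(x')`.
Here `x'` puts the added particle at `x_k` and the `k`-th one at `y`, with `y` between `x_new` and
`x_k`; only `k` with `x_k > x_new` (`ε = +`) or `x_k < x_new` (`ε = -`) occur. Each exchange
strictly decreases the number of such `k`, whence uniqueness (`eq_of_exchangeIntegral_recursion`).

For the propagated side (`propagation_emptyCreation_eq`), the commutation relation
`partialEnd_mul_permEnd` between `w^γ` and partial derivatives shows that, off the walls, a partial
derivative of a propagated function differs from the propagated derivative only by values at swapped
points. Since `∂_new ê f = iμ ê f`, the factor `e^{-iμ y}` leaves only these exchange terms. They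
are integrated from a position where the added particle is extreme; there propagation involves only
the old particles (`propagation_emptyCreation_of_extreme`).

For the creation side (`creation_eq`), the integration attached to the label next to the added
particle in the chain is performed outermost. What remains is the elementary operator of the shorter
tuple at the exchanged point (`tupleCreation_extTuple`).

That `w^γ` is independent of the word is obtained from the same commutation relation rather than
from braid relations: by induction on length, two words for `w` have the same commutators with
derivatives, and `wordEnd_eq_of_partialEnd` turns this into equality. -/

theorem hasFDerivAt_intervalIntegral_of_contDiff {F : H × ℝ → E} (hF : ContDiff ℝ 1 F)
    (a b : ℝ) (x₀ : H) :
    HasFDerivAt (fun x => ∫ t in a..b, F (x, t))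
      (∫ t in a..b, (fderiv ℝ F (x₀, t)).comp (ContinuousLinearMap.inl ℝ H ℝ)) x₀ := by
  have hF' : Continuous fun p : H × ℝ =>
      (fderiv ℝ F p).comp (ContinuousLinearMap.inl ℝ H ℝ) :=
    (hF.continuous_fderiv one_ne_zero).clm_comp continuous_const
  have hc : IsCompact (Metric.closedBall x₀ 1 ×ˢ Set.uIcc a b) :=
    (isCompact_closedBall x₀ 1).prod isCompact_uIcc
  obtain ⟨C, hC⟩ := hc.exists_bound_of_continuousOn hF'.continuousOn
  refine intervalIntegral.hasFDerivAt_integral_of_dominated_of_fderiv_le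
    (F := fun x t => F (x, t))
    (F' := fun x t => (fderiv ℝ F (x, t)).comp (ContinuousLinearMap.inl ℝ H ℝ))
    (bound := fun _ => C) (Metric.closedBall_mem_nhds x₀ one_pos) ?_ ?_ ?_ ?_ ?_ ?_
  · refine Filter.Eventually.of_forall fun x => Continuous.aestronglyMeasurable ?_
    exact hF.continuous.comp (by fun_prop : Continuous fun t : ℝ => (x, t))
  · exact (hF.continuous.comp (by fun_prop : Continuous fun t : ℝ => (x₀, t))).intervalIntegrable _ _
  · have : SecondCountableTopologyEither ℝ (H →L[ℝ] E) :=
      ⟨Or.inl inferInstance⟩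
    exact (hF'.comp (by fun_prop : Continuous fun t : ℝ => (x₀, t))).aestronglyMeasurable
  · refine Filter.Eventually.of_forall fun t ht x hx => hC (x, t) ⟨hx, Set.uIoc_subset_uIcc ht⟩
  · exact intervalIntegrable_const
  · refine Filter.Eventually.of_forall fun t _ x _ => ?_
    exact ((hF.differentiable one_ne_zero) (x, t)).hasFDerivAt.comp x
      ((hasFDerivAt_id x).prodMk (hasFDerivAt_const t x))

/-- The derivative of the integral is an integral with values in `H →L[ℝ] E`, so the target space
has to vary in the induction. This is also why `H` and `E` share a universe. -/
theorem contDiff_nat_intervalIntegral (n : ℕ) (a b : ℝ) :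
    ∀ {E : Type u} [NormedAddCommGroup E] [NormedSpace ℝ E] {F : H × ℝ → E}, ContDiff ℝ ∞ F →
      ContDiff ℝ n fun x => ∫ t in a..b, F (x, t) := by
  induction n with
  | zero =>
    intro E _ _ F hF
    refine contDiff_zero.2 (continuous_iff_continuousAt.2 fun x => ?_)
    exact (hasFDerivAt_intervalIntegral_of_contDiff
      (hF.of_le (by exact_mod_cast le_top)) a b x).continuousAt
  | succ n ih =>
    intro E _ _ F hF
    have h := hasFDerivAt_intervalIntegral_of_contDiff (hF.of_le (by exact_mod_cast le_top)) a b
    have hd : fderiv ℝ (fun x => ∫ t in a..b, F (x, t)) = _ := funext fun x => (h x).fderiv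
    refine contDiff_succ_iff_fderiv.2 ⟨fun x => (h x).differentiableAt,
      fun h => absurd h (WithTop.coe_ne_top (a := (n : ℕ∞))), ?_⟩
    rw [hd]
    exact ih (F := fun p => (fderiv ℝ F p).comp (ContinuousLinearMap.inl ℝ H ℝ))
      ((hF.fderiv_right (m := ∞) le_rfl).clm_comp contDiff_const)

theorem contDiff_intervalIntegral {F : H × ℝ → E} (hF : ContDiff ℝ ∞ F) (a b : ℝ) :
    ContDiff ℝ ∞ fun x => ∫ t in a..b, F (x, t) :=
  contDiff_infty.2 fun n => contDiff_nat_intervalIntegral n a b hF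

end ParametricIntegral

/-! ### Integration along a line -/

section LineIntegral

variable {H : Type} [NormedAddCommGroup H] [NormedSpace ℝ H]

/-- `x ↦ ∫_0^{φ x} f(x - y v) dy`. -/
def lineIntegral (φ : H →L[ℝ] ℝ) (v : H) (f : H → ℂ) (x : H) : ℂ :=
  ∫ y in (0 : ℝ)..(φ x), f (x - y • v)

/-- The substitution `y = t s` moves the variable endpoint `s` into the integrand, which reduces the
claim to fixed limits. -/
theorem contDiff_primitive_line [ProperSpace H] (v : H) {f : H → ℂ} (hf : ContDiff ℝ ∞ f) :
    ContDiff ℝ ∞ fun p : H × ℝ => ∫ y in (0 : ℝ)..p.2, f (p.1 - y • v) := by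
  have h : (fun p : H × ℝ => ∫ y in (0 : ℝ)..p.2, f (p.1 - y • v)) =
      fun p : H × ℝ => p.2 • ∫ t in (0 : ℝ)..1, f (p.1 - (t * p.2) • v) := by
    funext p
    rw [intervalIntegral.smul_integral_comp_mul_right (fun y => f (p.1 - y • v))]
    simp
  rw [h]
  refine contDiff_snd.smul (contDiff_intervalIntegral
    (F := fun q : (H × ℝ) × ℝ => f (q.1.1 - (q.2 * q.1.2) • v)) (hf.comp ?_) 0 1)
  fun_prop

theorem contDiff_lineIntegral [ProperSpace H] (φ : H →L[ℝ] ℝ) (v : H) {f : H → ℂ}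
    (hf : ContDiff ℝ ∞ f) : ContDiff ℝ ∞ (lineIntegral φ v f) :=
  (contDiff_primitive_line v hf).comp (contDiff_id.prodMk φ.contDiff)

/-- The integral is a function of the pair `(x, φ x)`. The direction `(u, φ u)` splits into `(u,
0)`, differentiated under the integral, and a multiple of `(0, 1)`, handled by the fundamental
theorem of calculus. -/
theorem fderiv_lineIntegral [ProperSpace H] (φ : H →L[ℝ] ℝ) (v : H) {f : H → ℂ}
    (hf : ContDiff ℝ ∞ f) (x u : H) :
    fderiv ℝ (lineIntegral φ v f) x u =
      lineIntegral φ v (fun z => fderiv ℝ f z u) x + (φ u : ℂ) * f (x - φ x • v) := by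
  set Φ : H × ℝ → ℂ := fun p => ∫ y in (0 : ℝ)..p.2, f (p.1 - y • v) with hΦ
  have hd : Differentiable ℝ Φ := (contDiff_primitive_line v hf).differentiable (by simp)
  have hfd : Differentiable ℝ f := hf.differentiable (by simp)
  have h1 : HasFDerivAt (lineIntegral φ v f)
      ((fderiv ℝ Φ (x, φ x)).comp ((ContinuousLinearMap.id ℝ H).prod φ)) x :=
    HasFDerivAt.comp (g := Φ) x (hd (x, φ x)).hasFDerivAt
      ((hasFDerivAt_id x).prodMk φ.hasFDerivAt)
  have h2 : HasDerivAt (fun s : ℝ => Φ (x, s)) (fderiv ℝ Φ (x, φ x) (0, 1)) (φ x) :=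
    (hd (x, φ x)).hasFDerivAt.comp_hasDerivAt (φ x)
      ((hasDerivAt_const _ x).prodMk (hasDerivAt_id _))
  have h2' : HasDerivAt (fun s : ℝ => Φ (x, s)) (f (x - φ x • v)) (φ x) := by
    have hc : Continuous fun y : ℝ => f (x - y • v) := hf.continuous.comp (by fun_prop)
    exact intervalIntegral.integral_hasDerivAt_right (hc.intervalIntegrable _ _)
      (hc.stronglyMeasurableAtFilter _ _) hc.continuousAt
  have h3 : HasFDerivAt (fun z : H => Φ (z, φ x))
      ((fderiv ℝ Φ (x, φ x)).comp (ContinuousLinearMap.inl ℝ H ℝ)) x :=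
    HasFDerivAt.comp (g := Φ) x (hd (x, φ x)).hasFDerivAt
      ((hasFDerivAt_id x).prodMk (hasFDerivAt_const (φ x) x))
  have hF : ContDiff ℝ ∞ fun q : H × ℝ => f (q.1 - q.2 • v) := hf.comp (by fun_prop)
  have h3' := hasFDerivAt_intervalIntegral_of_contDiff (hF.of_le (by exact_mod_cast le_top))
    0 (φ x) x
  have e3 := congrArg (fun L : H →L[ℝ] ℂ => L u) (h3.unique h3')
  have hcont : Continuous fun t : ℝ =>
      (fderiv ℝ (fun q : H × ℝ => f (q.1 - q.2 • v)) (x, t)).comp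
        (ContinuousLinearMap.inl ℝ H ℝ) :=
    ((hF.continuous_fderiv (by simp)).comp (by fun_prop : Continuous fun t : ℝ => (x, t))).clm_comp
      continuous_const
  have e4 : (∫ t in (0 : ℝ)..(φ x), (fderiv ℝ (fun q : H × ℝ => f (q.1 - q.2 • v)) (x, t)).comp
      (ContinuousLinearMap.inl ℝ H ℝ)) u = lineIntegral φ v (fun z => fderiv ℝ f z u) x := by
    rw [ContinuousLinearMap.intervalIntegral_apply (hcont.intervalIntegrable _ _), lineIntegral]
    congr 1
    funext t
    have h5 : HasFDerivAt (fun q : H × ℝ => f (q.1 - q.2 • v)) _ (x, t) :=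
      (hfd (x - t • v)).hasFDerivAt.comp (x, t)
        ((hasFDerivAt_fst (p := (x, t))).sub ((hasFDerivAt_snd (p := (x, t))).smul_const v))
    rw [h5.fderiv]
    simp
  rw [h1.fderiv]
  have hsplit : ((ContinuousLinearMap.id ℝ H).prod φ) u = (u, 0) + φ u • ((0, 1) : H × ℝ) := by
    simp
  rw [ContinuousLinearMap.comp_apply, hsplit, map_add, map_smul, h2.unique h2', ← e4, ← e3]
  simp

theorem lineIntegral_add (φ : H →L[ℝ] ℝ) (v : H) {f g : H → ℂ} (hf : Continuous f)
    (hg : Continuous g) (x : H) :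
    lineIntegral φ v (f + g) x = lineIntegral φ v f x + lineIntegral φ v g x := by
  have h : ∀ {f : H → ℂ}, Continuous f →
      IntervalIntegrable (fun y : ℝ => f (x - y • v)) MeasureTheory.volume 0 (φ x) := fun hf =>
    (hf.comp (by fun_prop)).intervalIntegrable _ _
  exact intervalIntegral.integral_add (h hf) (h hg)

theorem lineIntegral_smul (φ : H →L[ℝ] ℝ) (v : H) (c : ℂ) (f : H → ℂ) (x : H) :
    lineIntegral φ v (c • f) x = c * lineIntegral φ v f x :=
  intervalIntegral.integral_const_mul c _

/-- The integral of a derivative along the line. -/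
theorem lineIntegral_fderiv (φ : H →L[ℝ] ℝ) (v : H) {f : H → ℂ} (hf : ContDiff ℝ ∞ f) (x : H) :
    lineIntegral φ v (fun z => fderiv ℝ f z v) x = f x - f (x - φ x • v) := by
  have hfd : Differentiable ℝ f := hf.differentiable (by simp)
  have h : ∀ y : ℝ, HasDerivAt (fun y : ℝ => -f (x - y • v)) (fderiv ℝ f (x - y • v) v) y := by
    intro y
    have h1 : HasDerivAt (fun y : ℝ => x - y • v) (-v) y := by
      simpa using ((hasDerivAt_id y).smul_const v).const_sub x
    have h2 := ((hfd (x - y • v)).hasFDerivAt.comp_hasDerivAt y h1).neg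
    rw [map_neg, neg_neg] at h2
    exact h2
  have hc : Continuous fun y : ℝ => fderiv ℝ f (x - y • v) v :=
    ((hf.continuous_fderiv (by simp)).comp
      (by fun_prop : Continuous fun y : ℝ => x - y • v)).clm_apply continuous_const
  rw [lineIntegral, intervalIntegral.integral_eq_sub_of_hasDerivAt (fun y _ => h y)
    (hc.intervalIntegrable _ _)]
  simp; ring

end LineIntegral

/-! ### Integral-reflection operators of a hyperplane -/

section LineReflection

variable {H : Type} [NormedAddCommGroup H] [NormedSpace ℝ H]

/-- `f(x - φ(x) v) + γ ∫_0^{φ x} f(x - y v) dy`. -/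
def lineReflection (γ : ℝ) (φ : H →L[ℝ] ℝ) (v : H) (f : H → ℂ) (x : H) : ℂ :=
  f (x - φ x • v) + (γ : ℂ) * lineIntegral φ v f x

theorem contDiff_lineReflection [ProperSpace H] (γ : ℝ) (φ : H →L[ℝ] ℝ) (v : H) {f : H → ℂ}
    (hf : ContDiff ℝ ∞ f) : ContDiff ℝ ∞ (lineReflection γ φ v f) :=
  (hf.comp (by fun_prop)).add (contDiff_const.mul (contDiff_lineIntegral φ v hf))

theorem contDiff_fderiv_apply {f : H → ℂ} (hf : ContDiff ℝ ∞ f) (u : H) :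
    ContDiff ℝ ∞ fun z => fderiv ℝ f z u :=
  (hf.fderiv_right (m := ∞) le_rfl).clm_apply contDiff_const

/-- Replacing `u` by `u - φ u • v` under the integral costs `φ u (f x - f (x - φ x • v))` by
`lineIntegral_fderiv`. Its reflected part cancels the endpoint term of `fderiv_lineIntegral`, and `γ
φ(u) f(x)` is left. -/
theorem fderiv_lineReflection [ProperSpace H] (γ : ℝ) (φ : H →L[ℝ] ℝ) (v : H) {f : H → ℂ}
    (hf : ContDiff ℝ ∞ f) (x u : H) :
    fderiv ℝ (lineReflection γ φ v f) x u =
      lineReflection γ φ v (fun z => fderiv ℝ f z (u - φ u • v)) x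
        + (γ : ℂ) * (φ u : ℂ) * f x := by
  have hfd : Differentiable ℝ f := hf.differentiable (by simp)
  have h1 : HasFDerivAt (fun x => f (x - φ x • v)) _ x :=
    HasFDerivAt.comp (g := f) x (hfd (x - φ x • v)).hasFDerivAt
      ((hasFDerivAt_id x).sub (φ.hasFDerivAt.smul_const v))
  have h2 : HasFDerivAt (lineIntegral φ v f) _ x :=
    ((contDiff_lineIntegral φ v hf).differentiable (by simp) x).hasFDerivAt
  have h3 : HasFDerivAt (lineReflection γ φ v f) _ x := h1.add (h2.const_mul (γ : ℂ))
  have h4 : lineIntegral φ v (fun z => fderiv ℝ f z u) x =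
      lineIntegral φ v (fun z => fderiv ℝ f z (u - φ u • v)) x
        + (φ u : ℂ) * (f x - f (x - φ x • v)) := by
    rw [← lineIntegral_fderiv φ v hf, ← lineIntegral_smul, ← lineIntegral_add]
    · congr 1
      funext z
      simp
    · exact (contDiff_fderiv_apply hf _).continuous
    · exact (contDiff_fderiv_apply hf _).continuous.const_smul _
  rw [h3.fderiv, lineReflection]
  simp only [add_apply, ContinuousLinearMap.comp_apply, smul_apply, fderiv_lineIntegral φ v hf, h4, smul_eq_mul]
  simp
  ring

end LineReflection

/-! ### Words in the integral-reflection operators -/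

section Words

variable {n : ℕ}

/-- The linear form `x ↦ x_j - x_{j+1}`. -/
def rootForm (j : SimpleIndex n) : (Fin n → ℝ) →L[ℝ] ℝ :=
  ContinuousLinearMap.proj (R := ℝ) (φ := fun _ : Fin n => ℝ) j.fst -
    ContinuousLinearMap.proj (R := ℝ) (φ := fun _ : Fin n => ℝ) j.snd

/-- The vector `e_j - e_{j+1}`. -/
def rootVec (j : SimpleIndex n) : Fin n → ℝ := Pi.single j.fst 1 - Pi.single j.snd 1

theorem SimpleIndex.fst_ne_snd (j : SimpleIndex n) : j.fst ≠ j.snd := by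
  simp [SimpleIndex.fst, SimpleIndex.snd]

@[simp] theorem simpleSwap_inv (j : SimpleIndex n) : (simpleSwap j)⁻¹ = simpleSwap j :=
  Equiv.swap_inv _ _

@[simp] theorem simpleSwap_mul_self (j : SimpleIndex n) : simpleSwap j * simpleSwap j = 1 :=
  Equiv.swap_mul_self _ _

theorem permAct_simpleSwap (j : SimpleIndex n) (x : Fin n → ℝ) :
    permAct (simpleSwap j) x = x - rootForm j x • rootVec j := by
  funext i
  simp only [permAct, simpleSwap_inv]
  have hne := j.fst_ne_snd
  rcases eq_or_ne i j.fst with rfl | h1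
  · simp [simpleSwap, rootForm, rootVec, hne]
  · rcases eq_or_ne i j.snd with rfl | h2
    · simp [simpleSwap, rootForm, rootVec, hne.symm]
    · simp [simpleSwap, rootForm, rootVec, h1, h2, Equiv.swap_apply_of_ne_of_ne h1 h2]

/-- The abstract form is used a second time on `ℝ × ℝⁿ`, where functions carry an extra parameter
(`wordParam_cons`). -/
theorem integralReflection_eq (γ : ℝ) (j : SimpleIndex n) (f : (Fin n → ℝ) → ℂ) :
    integralReflection γ j f = lineReflection γ (rootForm j) (rootVec j) f := by
  funext x
  rw [integralReflection, simpleSwap_inv, permAct_simpleSwap]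
  rfl

theorem contDiff_integralReflection (γ : ℝ) (j : SimpleIndex n) {f : (Fin n → ℝ) → ℂ}
    (hf : ContDiff ℝ ∞ f) : ContDiff ℝ ∞ (integralReflection γ j f) := by
  rw [integralReflection_eq]
  exact contDiff_lineReflection γ _ _ hf

theorem contDiff_coe (f : smoothFun n) : ContDiff ℝ ∞ (f : (Fin n → ℝ) → ℂ) := f.2

theorem differentiable_coe (f : smoothFun n) : Differentiable ℝ (f : (Fin n → ℝ) → ℂ) :=
  (contDiff_coe f).differentiable (by simp)

/-- `s_j^γ` as an endomorphism of the space of smooth functions. -/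
def reflEnd (γ : ℝ) (j : SimpleIndex n) : Module.End ℂ (smoothFun n) where
  toFun f := ⟨integralReflection γ j f, contDiff_integralReflection γ j f.2⟩
  map_add' f g := by
    ext x
    have hf := (contDiff_coe f).continuous
    have hg := (contDiff_coe g).continuous
    change integralReflection γ j (f + g : (Fin n → ℝ) → ℂ) x =
      integralReflection γ j f x + integralReflection γ j g x
    simp only [integralReflection_eq, lineReflection, Pi.add_apply, lineIntegral_add _ _ hf hg]
    ring
  map_smul' c f := by
    ext x
    change integralReflection γ j (c • (f : (Fin n → ℝ) → ℂ)) x =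
      c * integralReflection γ j f x
    simp only [integralReflection_eq, lineReflection, Pi.smul_apply, lineIntegral_smul,
      smul_eq_mul]
    ring

/-- The partial derivative `∂_a` as an endomorphism of the space of smooth functions. -/
def partialEnd (a : Fin n) : Module.End ℂ (smoothFun n) where
  toFun f := ⟨fun x => fderiv ℝ (f : (Fin n → ℝ) → ℂ) x (Pi.single a 1),
    contDiff_fderiv_apply (contDiff_coe f) _⟩
  map_add' f g := by
    ext x
    have hf := differentiable_coe f
    have hg := differentiable_coe g
    change fderiv ℝ (f + g : (Fin n → ℝ) → ℂ) x _ = fderiv ℝ f x _ + fderiv ℝ g x _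
    simp [fderiv_add (hf x) (hg x)]
  map_smul' c f := by
    ext x
    have hf := differentiable_coe f
    change fderiv ℝ (c • (f : (Fin n → ℝ) → ℂ)) x _ = c * fderiv ℝ f x _
    simp [fderiv_const_smul (hf x) c]

theorem partialEnd_apply (a : Fin n) (f : smoothFun n) (x : Fin n → ℝ) :
    (partialEnd a f : (Fin n → ℝ) → ℂ) x = fderiv ℝ f x (Pi.single a 1) := rfl

/-- `∂_{s_j a} s_j^γ = s_j^γ ∂_a + γ (e_{s_j a})_{j} - γ (e_{s_j a})_{j+1}`. -/
theorem partialEnd_mul_reflEnd (γ : ℝ) (j : SimpleIndex n) (a : Fin n) :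
    partialEnd (simpleSwap j a) * reflEnd γ j = reflEnd γ j * partialEnd a +
      ((γ : ℂ) * ((if simpleSwap j a = j.fst then 1 else 0) -
        (if simpleSwap j a = j.snd then 1 else 0))) • 1 := by
  ext f x
  have h1 : (partialEnd (simpleSwap j a) (reflEnd γ j f) : (Fin n → ℝ) → ℂ) x =
      fderiv ℝ (lineReflection γ (rootForm j) (rootVec j) f) x
        (Pi.single (simpleSwap j a) 1) := by
    rw [← integralReflection_eq]; rfl
  have h2 : (Pi.single (simpleSwap j a) 1 : Fin n → ℝ) -
      rootForm j (Pi.single (simpleSwap j a) 1) • rootVec j = Pi.single a 1 := by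
    rw [← permAct_simpleSwap]
    funext i
    simp only [permAct, simpleSwap_inv, Pi.single_apply]
    simp
  have h3 : ((rootForm j (Pi.single (simpleSwap j a) 1) : ℝ) : ℂ) =
      (if simpleSwap j a = j.fst then 1 else 0) - (if simpleSwap j a = j.snd then 1 else 0) := by
    simp only [rootForm, sub_apply, ContinuousLinearMap.proj_apply, Pi.single_apply, eq_comm]
    split_ifs <;> simp
  have h4 : (reflEnd γ j (partialEnd a f) : (Fin n → ℝ) → ℂ) x =
      lineReflection γ (rootForm j) (rootVec j) (fun z => fderiv ℝ f z (Pi.single a 1)) x := by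
    rw [← integralReflection_eq]; rfl
  simp only [Module.End.mul_apply, h1, fderiv_lineReflection γ _ _ f.2, h2, h3,
    LinearMap.add_apply, Submodule.coe_add, Pi.add_apply, h4, LinearMap.smul_apply,
    Submodule.coe_smul, Pi.smul_apply, Module.End.one_apply, smul_eq_mul]

/-- The product of simple transpositions along a word. -/
def wordPerm (l : List (SimpleIndex n)) : Equiv.Perm (Fin n) := (l.map simpleSwap).prod

@[simp] theorem wordPerm_nil : wordPerm ([] : List (SimpleIndex n)) = 1 := rfl

@[simp] theorem wordPerm_cons (j : SimpleIndex n) (l : List (SimpleIndex n)) :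
    wordPerm (j :: l) = simpleSwap j * wordPerm l := by
  simp [wordPerm]

/-- `s_{i₁}^γ ⋯ s_{i_l}^γ` as an endomorphism of the space of smooth functions. -/
def wordEnd (γ : ℝ) (l : List (SimpleIndex n)) : Module.End ℂ (smoothFun n) :=
  (l.map (reflEnd γ)).prod

@[simp] theorem wordEnd_nil (γ : ℝ) : wordEnd γ ([] : List (SimpleIndex n)) = 1 := rfl

@[simp] theorem wordEnd_cons (γ : ℝ) (j : SimpleIndex n) (l : List (SimpleIndex n)) :
    wordEnd γ (j :: l) = reflEnd γ j * wordEnd γ l := by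
  simp [wordEnd]

theorem coe_wordEnd (γ : ℝ) (l : List (SimpleIndex n)) (f : smoothFun n) :
    (wordEnd γ l f : (Fin n → ℝ) → ℂ) = wordOp γ l f := by
  induction l with
  | nil => rfl
  | cons j l ih =>
    rw [wordEnd_cons, Module.End.mul_apply]
    change integralReflection γ j (wordEnd γ l f) = integralReflection γ j (wordOp γ l f)
    rw [ih]

/-- All root forms vanish at the origin. This supplies the common initial value when two words are
compared in `wordEnd_eq_of_partialEnd`. -/
theorem wordEnd_apply_zero (γ : ℝ) (l : List (SimpleIndex n)) (f : smoothFun n) :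
    (wordEnd γ l f : (Fin n → ℝ) → ℂ) 0 = (f : (Fin n → ℝ) → ℂ) 0 := by
  induction l with
  | nil => rfl
  | cons j l ih =>
    rw [wordEnd_cons, Module.End.mul_apply]
    change integralReflection γ j (wordEnd γ l f) 0 = _
    rw [integralReflection_eq, ← ih]
    simp [lineReflection, lineIntegral]

/-- The coefficients of the commutation relation of `w^γ` with the partial derivatives. -/
def inversionCoeff (w : Equiv.Perm (Fin n)) (a b : Fin n) : ℂ :=
  (if b < a then 1 else 0) - (if w b < w a then 1 else 0)

@[simp] theorem inversionCoeff_one (a b : Fin n) : inversionCoeff 1 a b = 0 := sub_self _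

/-- A simple transposition reverses the order of a single pair of labels, the two that it
interchanges. -/
theorem simpleSwap_lt_sub (j : SimpleIndex n) (p q : Fin n) :
    ((if q < p then 1 else 0) - (if simpleSwap j q < simpleSwap j p then 1 else 0) : ℂ) =
      if q = simpleSwap j p then (if simpleSwap j p = j.fst then 1 else 0) -
        (if simpleSwap j p = j.snd then 1 else 0) else 0 := by
  obtain ⟨j, hj⟩ := j
  obtain ⟨p, hp⟩ := p
  obtain ⟨q, hq⟩ := q
  simp only [simpleSwap, SimpleIndex.fst, SimpleIndex.snd, Equiv.swap_apply_def, Fin.mk.injEq]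
  split_ifs <;> simp_all <;> omega

theorem inversionCoeff_simpleSwap_mul (j : SimpleIndex n) (w : Equiv.Perm (Fin n))
    (a b : Fin n) :
    inversionCoeff (simpleSwap j * w) a b = inversionCoeff w a b +
      if w b = simpleSwap j (w a) then (if simpleSwap j (w a) = j.fst then 1 else 0) -
        (if simpleSwap j (w a) = j.snd then 1 else 0) else 0 := by
  rw [← simpleSwap_lt_sub]
  change ((if b < a then 1 else 0) -
    (if simpleSwap j (w b) < simpleSwap j (w a) then 1 else 0) : ℂ) =
    ((if b < a then 1 else 0) - (if w b < w a then 1 else 0)) + _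
  ring

/-- Conjugation gives `w (a b) = (w a, w b) w`, and under the hypotheses `(w a, w b)` is `s_j`. -/
theorem simpleSwap_mul_mul_swap {j : SimpleIndex n} {w : Equiv.Perm (Fin n)} {a b : Fin n}
    (h : w b = simpleSwap j (w a)) (hne : simpleSwap j (w a) ≠ w a) :
    simpleSwap j * (w * Equiv.swap a b) = w := by
  have hs : Equiv.swap (w a) (w b) = simpleSwap j := by
    rw [h]
    have hw : w a = j.fst ∨ w a = j.snd := by
      by_contra! hc
      exact hne (Equiv.swap_apply_of_ne_of_ne hc.1 hc.2)
    rcases hw with hw | hw <;> rw [hw]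
    · simp [simpleSwap]
    · simp [simpleSwap, Equiv.swap_comm]
  rw [Equiv.mul_swap_eq_swap_mul, hs, ← mul_assoc, simpleSwap_mul_self, one_mul]

theorem simpleSwap_apply_ne {j : SimpleIndex n} {p : Fin n}
    (h : ((if simpleSwap j p = j.fst then 1 else 0) -
      (if simpleSwap j p = j.snd then 1 else 0) : ℂ) ≠ 0) : simpleSwap j p ≠ p := by
  intro hp
  rw [hp] at h
  have h1 : p ≠ j.fst := by
    rintro rfl
    exact j.fst_ne_snd (by simpa [simpleSwap] using hp.symm)
  have h2 : p ≠ j.snd := by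
    rintro rfl
    exact j.fst_ne_snd (by simpa [simpleSwap] using hp)
  simp [h1, h2] at h

/-- The exchange property. -/
theorem exists_shorter_word (l : List (SimpleIndex n)) (a b : Fin n)
    (h : inversionCoeff (wordPerm l) a b ≠ 0) :
    ∃ l' : List (SimpleIndex n), l'.length < l.length ∧
      wordPerm l' = wordPerm l * Equiv.swap a b := by
  induction l with
  | nil => simp at h
  | cons j l ih =>
    -- The letter to delete is the one at which the pair `a, b` first becomes inverted, reading the
    -- word from its right end.
    by_cases h0 : inversionCoeff (wordPerm l) a b = 0
    · rw [wordPerm_cons, inversionCoeff_simpleSwap_mul, h0, zero_add] at h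
      obtain ⟨h1, h2⟩ := ite_ne_right_iff.1 h
      have h3 := simpleSwap_mul_mul_swap h1 (simpleSwap_apply_ne h2)
      exact ⟨l, by simp, by rw [wordPerm_cons, mul_assoc, h3]⟩
    · obtain ⟨l', h1, h2⟩ := ih h0
      exact ⟨j :: l', by simpa using h1, by rw [wordPerm_cons, wordPerm_cons, h2, mul_assoc]⟩

/-- A word of minimal length for a permutation. -/
theorem exists_shortest_word (w : Equiv.Perm (Fin n)) : ∃ l : List (SimpleIndex n),
    wordPerm l = w ∧ ∀ l', wordPerm l' = w → l.length ≤ l'.length := by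
  obtain ⟨l₀, h₀⟩ := exists_word w
  obtain ⟨l, hl⟩ := exists_minimalFor_of_wellFoundedLT (fun l => wordPerm l = w) List.length
    ⟨l₀, h₀⟩
  refine ⟨l, hl.1, fun l' hl' => ?_⟩
  rcases le_total l.length l'.length with h | h
  · exact h
  · exact hl.2 hl' h

/-- The operator along a shortest word of a permutation. -/
def shortestEnd (γ : ℝ) (w : Equiv.Perm (Fin n)) : Module.End ℂ (smoothFun n) :=
  wordEnd γ (exists_shortest_word w).choose

/-- The commutation relation of `w^γ` with `∂_a`, for words of bounded length. -/
theorem partialEnd_mul_wordEnd_aux (γ : ℝ) (L : ℕ)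
    (hL : ∀ l : List (SimpleIndex n), l.length < L → wordEnd γ l = shortestEnd γ (wordPerm l))
    (a : Fin n) (l : List (SimpleIndex n)) (hl : l.length ≤ L) :
    partialEnd (wordPerm l a) * wordEnd γ l = wordEnd γ l * partialEnd a +
      (γ : ℂ) • ∑ b, inversionCoeff (wordPerm l) a b •
        shortestEnd γ (wordPerm l * Equiv.swap a b) := by
  induction l with
  | nil => simp
  | cons j l ih =>
    have hlt : l.length < L := by simpa using hl
    set w := wordPerm l with hw
    set d : ℂ := (if simpleSwap j (w a) = j.fst then 1 else 0) -
      (if simpleSwap j (w a) = j.snd then 1 else 0) with hd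
    -- A nonzero coefficient provides a word for `w (a b)` shorter than `l`. Prefixing `j` still
    -- gives length below `L`, so `hL` applies before and after.
    have h1 : ∀ b, inversionCoeff w a b • (reflEnd γ j * shortestEnd γ (w * Equiv.swap a b)) =
        inversionCoeff w a b • shortestEnd γ (simpleSwap j * (w * Equiv.swap a b)) := by
      intro b
      by_cases h0 : inversionCoeff w a b = 0
      · simp [h0]
      · obtain ⟨l', hl', hp⟩ := exists_shorter_word l a b h0
        rw [← hw] at hp
        rw [← hp, ← hL l' (hl'.trans hlt), ← wordEnd_cons, ← wordPerm_cons,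
          ← hL (j :: l') (by simpa using lt_of_le_of_lt hl' hlt)]
    -- The one coefficient altered by the letter `j` belongs to `b` with `s_j w (a b) = w`; its term
    -- is exactly the scalar term of `partialEnd_mul_reflEnd`.
    have h2 : ∀ b, (if w b = simpleSwap j (w a) then d else 0) •
        shortestEnd γ (simpleSwap j * (w * Equiv.swap a b)) =
        if b = w⁻¹ (simpleSwap j (w a)) then d • wordEnd γ l else 0 := by
      intro b
      have hiff : b = w⁻¹ (simpleSwap j (w a)) ↔ w b = simpleSwap j (w a) := by
        rw [Equiv.Perm.eq_inv_iff_eq]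
      simp only [hiff]
      split_ifs with h
      · by_cases h0 : d = 0
        · simp [h0]
        · rw [simpleSwap_mul_mul_swap h (simpleSwap_apply_ne h0), hw, ← hL l hlt]
      · simp
    simp only [wordPerm_cons, wordEnd_cons, inversionCoeff_simpleSwap_mul, ← hw, ← hd, add_smul,
      Finset.sum_add_distrib, mul_assoc, h2, ← h1]
    rw [Equiv.Perm.mul_apply, ← mul_assoc, partialEnd_mul_reflEnd, add_mul, mul_assoc, ih hlt.le,
      Finset.sum_ite_eq' Finset.univ, if_pos (Finset.mem_univ _), ← hd, mul_add, mul_smul_comm,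
      Finset.mul_sum, smul_add, smul_mul_assoc, one_mul, smul_smul, add_assoc]
    simp only [mul_smul_comm]

/-! ### Independence of the word -/

/-- The operator along a word, applied to functions that depend on a parameter. -/
def wordParam (γ : ℝ) (l : List (SimpleIndex n)) (F : ℝ × (Fin n → ℝ) → ℂ)
    (p : ℝ × (Fin n → ℝ)) : ℂ :=
  wordOp γ l (fun z => F (p.1, z)) p.2

theorem wordParam_cons (γ : ℝ) (j : SimpleIndex n) (l : List (SimpleIndex n))
    (F : ℝ × (Fin n → ℝ) → ℂ) :
    wordParam γ (j :: l) F = lineReflection γ ((rootForm j).comp (ContinuousLinearMap.snd ℝ ℝ _))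
      (0, rootVec j) (wordParam γ l F) := by
  funext p
  change integralReflection γ j (wordOp γ l fun z => F (p.1, z)) p.2 = _
  rw [integralReflection_eq]
  simp [lineReflection, lineIntegral, wordParam]

theorem contDiff_wordParam (γ : ℝ) (l : List (SimpleIndex n)) {F : ℝ × (Fin n → ℝ) → ℂ}
    (hF : ContDiff ℝ ∞ F) : ContDiff ℝ ∞ (wordParam γ l F) := by
  induction l with
  | nil => exact hF
  | cons j l ih =>
    rw [wordParam_cons]
    exact contDiff_lineReflection _ _ _ ih

/-- The parameter direction lies in the kernel of every root form, so neither a reflection of the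
direction nor a boundary term appears. -/
theorem fderiv_wordParam (γ : ℝ) (l : List (SimpleIndex n)) {F : ℝ × (Fin n → ℝ) → ℂ}
    (hF : ContDiff ℝ ∞ F) (p : ℝ × (Fin n → ℝ)) :
    fderiv ℝ (wordParam γ l F) p (1, 0) = wordParam γ l (fun q => fderiv ℝ F q (1, 0)) p := by
  induction l generalizing p with
  | nil => rfl
  | cons j l ih =>
    rw [wordParam_cons, wordParam_cons, fderiv_lineReflection _ _ _ (contDiff_wordParam γ l hF)]
    have h0 : ((rootForm j).comp (ContinuousLinearMap.snd ℝ ℝ (Fin n → ℝ))) (1, 0) = 0 := by simp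
    simp only [h0, zero_smul, sub_zero, Complex.ofReal_zero, mul_zero, zero_mul, add_zero]
    congr 1
    exact funext ih

/-- The directional derivative `∂_u`. -/
theorem sum_smul_partialEnd_apply (u : Fin n → ℝ) (f : smoothFun n) (x : Fin n → ℝ) :
    ((∑ a, (u a : ℂ) • partialEnd a) f : smoothFun n).1 x = fderiv ℝ f x u := by
  have hu : u = ∑ a, u a • (Pi.single a 1 : Fin n → ℝ) := by
    funext i
    simp [Finset.sum_apply, Pi.single_apply]
  conv_rhs => rw [hu, map_sum]
  rw [LinearMap.sum_apply, AddSubmonoidClass.coe_finsetSum, Finset.sum_apply]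
  refine Finset.sum_congr rfl fun a _ => ?_
  rw [map_smul]
  rfl

/-- Apply the operator of a word to the translate `z ↦ f (z + (1 - t) u)` and evaluate at `t x`. The
`t`-derivative is a combination of commutators with derivatives, hence the same for both words. At
`t = 0` the evaluation is at the origin, where words act trivially; at `t = 1` it is the desired
value. -/
theorem wordEnd_eq_of_partialEnd (γ : ℝ) (l l' : List (SimpleIndex n)) (w : Equiv.Perm (Fin n))
    (h : ∀ a, partialEnd (w a) * wordEnd γ l - wordEnd γ l * partialEnd a =
      partialEnd (w a) * wordEnd γ l' - wordEnd γ l' * partialEnd a) :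
    wordEnd γ l = wordEnd γ l' := by
  ext f x
  -- With these weights the derivatives `∂_{w a}` on the left add up to `∂_x`, and the `∂_a` on the
  -- right to `∂_u`.
  set u : Fin n → ℝ := fun a => x (w a) with hu
  have hdir : ∀ (g : smoothFun n) (y : Fin n → ℝ),
      fderiv ℝ (wordEnd γ l g) y x - (wordEnd γ l (∑ a, (u a : ℂ) • partialEnd a g)).1 y =
      fderiv ℝ (wordEnd γ l' g) y x - (wordEnd γ l' (∑ a, (u a : ℂ) • partialEnd a g)).1 y := by
    intro g y
    have key : ∀ k : List (SimpleIndex n),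
        fderiv ℝ (wordEnd γ k g) y x - (wordEnd γ k (∑ a, (u a : ℂ) • partialEnd a g)).1 y =
        ((∑ a, (u a : ℂ) • (partialEnd (w a) * wordEnd γ k - wordEnd γ k * partialEnd a)) g).1
          y := by
      intro k
      rw [← sum_smul_partialEnd_apply, ← Equiv.sum_comp w]
      simp only [smul_sub, Finset.sum_sub_distrib, LinearMap.sub_apply, LinearMap.sum_apply,
        LinearMap.smul_apply, Module.End.mul_apply, map_sum, map_smul]
      rfl
    rw [key, key]
    simp only [h]
  set F : ℝ × (Fin n → ℝ) → ℂ := fun p => (f : (Fin n → ℝ) → ℂ) (p.2 + (1 - p.1) • u) with hF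
  have hFs : ContDiff ℝ ∞ F := (contDiff_coe f).comp (by fun_prop)
  let g : ℝ → smoothFun n := fun t => ⟨fun z => F (t, z), hFs.comp (by fun_prop)⟩
  have hdF : ∀ q, fderiv ℝ F q (1, 0) = -fderiv ℝ (g q.1) q.2 u := by
    intro q
    have h1 : HasFDerivAt F _ q := HasFDerivAt.comp (g := (f : (Fin n → ℝ) → ℂ)) q
      (differentiable_coe f (q.2 + (1 - q.1) • u)).hasFDerivAt
      (hasFDerivAt_snd.add ((hasFDerivAt_fst.const_sub 1).smul_const u))
    have h2 : HasFDerivAt (fun z => F (q.1, z)) _ q.2 :=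
      HasFDerivAt.comp (g := (f : (Fin n → ℝ) → ℂ)) q.2
      (differentiable_coe f (q.2 + (1 - q.1) • u)).hasFDerivAt
      ((hasFDerivAt_id q.2).add_const ((1 - q.1) • u))
    change _ = -fderiv ℝ (fun z => F (q.1, z)) q.2 u
    rw [h1.fderiv, h2.fderiv]
    simp
  have hparam : ∀ k t y, wordParam γ k F (t, y) = (wordEnd γ k (g t)).1 y := by
    intro k t y
    rw [coe_wordEnd]; rfl
  have hderiv : ∀ (k : List (SimpleIndex n)) (t : ℝ),
      HasDerivAt (fun t : ℝ => wordParam γ k F (t, t • x))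
        (fderiv ℝ (wordEnd γ k (g t)) (t • x) x -
          (wordEnd γ k (∑ a, (u a : ℂ) • partialEnd a (g t))).1 (t • x)) t := by
    intro k t
    have hd : Differentiable ℝ (wordParam γ k F) :=
      (contDiff_wordParam γ k hFs).differentiable (by simp)
    have h1 : HasDerivAt (fun t : ℝ => wordParam γ k F (t, t • x)) _ t :=
      HasFDerivAt.comp_hasDerivAt (l := wordParam γ k F) t (hd (t, t • x)).hasFDerivAt
        ((hasDerivAt_id t).prodMk ((hasDerivAt_id t).smul_const x))
    convert h1 using 1
    have hs : ((1, (1 : ℝ) • x) : ℝ × (Fin n → ℝ)) = (1, 0) + (0, x) := by simp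
    rw [hs, map_add, fderiv_wordParam γ k hFs]
    have h2 : HasFDerivAt (fun y => wordParam γ k F (t, y)) _ (t • x) :=
      HasFDerivAt.comp (g := wordParam γ k F) (t • x) (hd (t, t • x)).hasFDerivAt
        ((hasFDerivAt_const t (t • x)).prodMk (hasFDerivAt_id (t • x)))
    have h3 : fderiv ℝ (wordEnd γ k (g t)) (t • x) x =
        fderiv ℝ (wordParam γ k F) (t, t • x) (0, x) := by
      have : ((wordEnd γ k (g t)) : (Fin n → ℝ) → ℂ) = fun y => wordParam γ k F (t, y) :=
        funext fun y => (hparam k t y).symm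
      rw [this, h2.fderiv]
      simp
    have h4 : wordParam γ k (fun q => fderiv ℝ F q (1, 0)) (t, t • x) =
        -(wordEnd γ k (∑ a, (u a : ℂ) • partialEnd a (g t))).1 (t • x) := by
      have h5 : (fun z => fderiv ℝ F (t, z) (1, 0)) =
          ((-∑ a, (u a : ℂ) • partialEnd a (g t) : smoothFun n) : (Fin n → ℝ) → ℂ) := by
        funext z
        rw [hdF, ← sum_smul_partialEnd_apply]
        simp only [LinearMap.sum_apply, LinearMap.smul_apply]
        rfl
      rw [wordParam, h5, ← coe_wordEnd, map_neg]
      rfl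
    rw [h3, h4]
    ring
  have hconst : ∀ t, (wordParam γ l F (t, t • x) - wordParam γ l' F (t, t • x)) =
      (wordParam γ l F (0, (0 : ℝ) • x) - wordParam γ l' F (0, (0 : ℝ) • x)) := by
    intro t
    refine is_const_of_deriv_eq_zero (𝕜 := ℝ)
      (f := fun t : ℝ => wordParam γ l F (t, t • x) - wordParam γ l' F (t, t • x))
      (fun t => ((hderiv l t).sub (hderiv l' t)).differentiableAt) (fun t => ?_) t 0
    refine ((hderiv l t).sub (hderiv l' t)).deriv.trans ?_
    rw [hdir, sub_self]
  have h0 := hconst 1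
  have hg1 : g 1 = f := by
    ext z
    simp [g, hF]
  simpa [hparam, wordEnd_apply_zero, hg1, sub_eq_zero] using h0

/-- The right-hand side of the commutation relation beyond the leading term depends only on the
permutation, so a word and a shortest word for the same permutation have equal commutators. The
relation at length at most `L` needs independence only below `L`, which drives the induction. -/
theorem wordEnd_eq_shortestEnd (γ : ℝ) (L : ℕ) : ∀ l : List (SimpleIndex n), l.length < L →
    wordEnd γ l = shortestEnd γ (wordPerm l) := by
  induction L with
  | zero => simp
  | succ L ih =>
    intro l hl
    have hs := (exists_shortest_word (wordPerm l)).choose_spec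
    set l' := (exists_shortest_word (wordPerm l)).choose with hl'
    refine wordEnd_eq_of_partialEnd γ l l' (wordPerm l) fun a => ?_
    rw [partialEnd_mul_wordEnd_aux γ L ih a l (Nat.lt_succ_iff.1 hl)]
    conv_rhs => rw [← hs.1]
    rw [partialEnd_mul_wordEnd_aux γ L ih a l' ((hs.2 l rfl).trans (Nat.lt_succ_iff.1 hl)), hs.1]
    abel

theorem wordEnd_congr (γ : ℝ) {l l' : List (SimpleIndex n)} (h : wordPerm l = wordPerm l') :
    wordEnd γ l = wordEnd γ l' := by
  rw [wordEnd_eq_shortestEnd γ _ l (Nat.lt_succ_self _),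
    wordEnd_eq_shortestEnd γ _ l' (Nat.lt_succ_self _), h]

/-- `w^γ` as an endomorphism of the space of smooth functions. -/
def permEnd (γ : ℝ) (w : Equiv.Perm (Fin n)) : Module.End ℂ (smoothFun n) :=
  wordEnd γ (exists_word w).choose

theorem coe_permEnd (γ : ℝ) (w : Equiv.Perm (Fin n)) (f : smoothFun n) :
    (permEnd γ w f : (Fin n → ℝ) → ℂ) = permOp γ w f :=
  coe_wordEnd γ _ f

/-- The operator `w^γ` does not depend on the decomposition of `w`. -/
theorem permEnd_wordPerm (γ : ℝ) (l : List (SimpleIndex n)) :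
    permEnd γ (wordPerm l) = wordEnd γ l :=
  wordEnd_congr γ (exists_word (wordPerm l)).choose_spec

theorem exists_wordPerm_eq (w : Equiv.Perm (Fin n)) : ∃ l, wordPerm l = w := exists_word w

/-- Independence of the word removes the length restriction from `partialEnd_mul_wordEnd_aux`. This
is the relation behind the derivatives of propagated functions. -/
theorem partialEnd_mul_permEnd (γ : ℝ) (w : Equiv.Perm (Fin n)) (a : Fin n) :
    partialEnd (w a) * permEnd γ w = permEnd γ w * partialEnd a +
      (γ : ℂ) • ∑ b, inversionCoeff w a b • permEnd γ (w * Equiv.swap a b) := by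
  obtain ⟨l, rfl⟩ := exists_wordPerm_eq w
  have hs : ∀ v : Equiv.Perm (Fin n), shortestEnd γ v = permEnd γ v := by
    intro v
    obtain ⟨l, rfl⟩ := exists_wordPerm_eq v
    rw [permEnd_wordPerm, wordEnd_eq_shortestEnd γ _ l (Nat.lt_succ_self _)]
  have h := partialEnd_mul_wordEnd_aux γ l.length (fun l' _ => wordEnd_eq_shortestEnd γ _ l'
    (Nat.lt_succ_self _)) a l le_rfl
  simpa only [hs, permEnd_wordPerm] using h

end Words

/-! ### The propagation operator -/

section Propagation

variable {n : ℕ}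

theorem permAct_mul (v w : Equiv.Perm (Fin n)) (x : Fin n → ℝ) :
    permAct (v * w) x = permAct v (permAct w x) := by
  funext i
  simp [permAct]

theorem permAct_apply_apply (w : Equiv.Perm (Fin n)) (x : Fin n → ℝ) (a : Fin n) :
    permAct w x (w a) = x a := by
  simp [permAct]

theorem contDiff_permAct (w : Equiv.Perm (Fin n)) : ContDiff ℝ ∞ (permAct w) :=
  contDiff_pi.2 fun i => contDiff_apply ℝ ℝ (w⁻¹ i)

theorem permAct_update (w : Equiv.Perm (Fin n)) (x : Fin n → ℝ) (a : Fin n) (y : ℝ) :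
    permAct w (Function.update x a y) = Function.update (permAct w x) (w a) y := by
  funext i
  have h : w⁻¹ i = a ↔ i = w a := by rw [Equiv.Perm.inv_eq_iff_eq]
  simp only [permAct, Function.update_apply, h]

theorem permEnd_mul (γ : ℝ) (v w : Equiv.Perm (Fin n)) :
    permEnd γ (v * w) = permEnd γ v * permEnd γ w := by
  obtain ⟨l, rfl⟩ := exists_wordPerm_eq v
  obtain ⟨l', rfl⟩ := exists_wordPerm_eq w
  have h : wordPerm l * wordPerm l' = wordPerm (l ++ l') := by simp [wordPerm]
  rw [h, permEnd_wordPerm, permEnd_wordPerm, permEnd_wordPerm]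
  simp [wordEnd]

/-- If `u⁻¹` preserves the order of all neighbours, it is an order automorphism of `Fin n`, hence
trivial. -/
theorem exists_descent {u : Equiv.Perm (Fin n)} (hu : u ≠ 1) :
    ∃ j : SimpleIndex n, u⁻¹ j.snd < u⁻¹ j.fst := by
  by_contra! h
  apply hu
  rw [← inv_eq_one]
  cases n with
  | zero => exact Subsingleton.elim _ _
  | succ n =>
    have hs : StrictMono (u⁻¹ : Equiv.Perm (Fin (n + 1))) := by
      refine Fin.strictMono_iff_lt_succ.2 fun i => ?_
      refine lt_of_le_of_ne (h ⟨i.1, Nat.succ_lt_succ i.2⟩) fun he => ?_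
      exact (Fin.castSucc_lt_succ (i := i)).ne (u⁻¹.injective he)
    have h1 : OrderIso.refl (Fin (n + 1)) = hs.orderIsoOfSurjective _ (u⁻¹).surjective :=
      Subsingleton.elim _ _
    ext i
    exact congrArg Fin.val (congrArg (fun e : Fin (n + 1) ≃o Fin (n + 1) => e i) h1).symm

/-- This makes the formulas for `P^γ` agree on common walls. If `u ≠ 1` fixes the sorted vector `z`,
a descent `j` of `u` forces `z_j = z_{j+1}`. Then `s_j^γ` preserves values at `z`, and the exchange
property splits `s_j` off from `u`. -/
theorem wordEnd_apply_of_fixed (γ : ℝ) (g : smoothFun n) {z : Fin n → ℝ} (hz : Antitone z)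
    (L : ℕ) : ∀ l : List (SimpleIndex n), l.length < L → permAct (wordPerm l) z = z →
      (wordEnd γ l g).1 z = g.1 z := by
  induction L with
  | zero => simp
  | succ L ih =>
    intro l hl hfix
    by_cases hu : wordPerm l = 1
    · rw [wordEnd_congr γ (l' := []) (by simpa using hu)]
      rfl
    · obtain ⟨j, hj⟩ := exists_descent hu
      set u := wordPerm l with hudef
      obtain ⟨l', hl', hp⟩ := exists_shorter_word l (u⁻¹ j.fst) (u⁻¹ j.snd) (by
        have : ¬ j.snd < j.fst := by simp [SimpleIndex.fst, SimpleIndex.snd]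
        rw [inversionCoeff, ← hudef]
        rw [if_pos hj]
        simp [this])
      have hp' : wordPerm l' = simpleSwap j * u := by
        rw [hp, ← hudef, Equiv.mul_swap_eq_swap_mul]
        simp [simpleSwap]
      have hroot : rootForm j z = 0 := by
        have h1 : z j.fst = z (u⁻¹ j.fst) := (congrFun hfix j.fst).symm
        have h2 : z j.snd = z (u⁻¹ j.snd) := (congrFun hfix j.snd).symm
        have h3 : z (u⁻¹ j.fst) ≤ z (u⁻¹ j.snd) := hz hj.le
        have h4 : z j.snd ≤ z j.fst := hz (by simp [SimpleIndex.fst, SimpleIndex.snd])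
        change z j.fst - z j.snd = 0
        linarith
      have hfix' : permAct (wordPerm l') z = z := by
        rw [hp', permAct_mul, hfix, permAct_simpleSwap, hroot]
        simp
      rw [wordEnd_congr γ (l' := j :: l') (by rw [wordPerm_cons, hp', ← mul_assoc]; simp [← hudef]),
        wordEnd_cons, ← ih l' (by omega) hfix']
      change integralReflection γ j (wordEnd γ l' g) z = _
      rw [integralReflection_eq, lineReflection, lineIntegral, hroot]
      simp

/-- The formula for `P^γ_{(n)} f` on `w⁻¹ ℝⁿ₊` is valid on the closure. -/
theorem propagation_of_antitone (γ : ℝ) (f : smoothFun n) {w : Equiv.Perm (Fin n)}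
    {x : Fin n → ℝ} (hx : Antitone (permAct w x)) :
    propagation γ f.1 x = (permEnd γ w f).1 (permAct w x) := by
  set σ := sortPerm x with hσ
  have hz : Antitone (permAct σ x) := antitone_sortPerm x
  -- The sorted rearrangement of `x` is unique, so `w σ⁻¹` stabilizes it even when `w ≠ σ`.
  have heq : permAct w x = permAct σ x :=
    Tuple.unique_antitone (f := x) (σ := w⁻¹) (τ := σ⁻¹) hx hz
  rw [propagation, ← hσ, ← coe_permEnd, heq]
  have hw : w = (w * σ⁻¹) * σ := by simp
  obtain ⟨l, hl⟩ := exists_wordPerm_eq (w * σ⁻¹)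
  rw [hw, permEnd_mul, Module.End.mul_apply, ← hl, permEnd_wordPerm]
  refine (wordEnd_apply_of_fixed γ _ hz _ l (Nat.lt_succ_self _) ?_).symm
  rw [hl, ← permAct_mul, ← hw, heq]

/-- Finitely many closed chambers cover the space, and on each of them the function agrees with a
smooth one. -/
theorem continuous_propagation (γ : ℝ) (f : smoothFun n) : Continuous (propagation γ f.1) := by
  refine LocallyFinite.continuous
    (f := fun w : Equiv.Perm (Fin n) => {x : Fin n → ℝ | Antitone (permAct w x)})
    (locallyFinite_of_finite _) ?_ ?_ ?_
  · exact Set.eq_univ_of_forall fun x => Set.mem_iUnion.2 ⟨_, antitone_sortPerm x⟩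
  · intro w
    simp only [Antitone, Set.ofPred_forall]
    refine isClosed_iInter fun i => isClosed_iInter fun j => isClosed_iInter fun _ => ?_
    exact isClosed_le (continuous_apply (w⁻¹ j)) (continuous_apply (w⁻¹ i))
  · intro w
    refine ContinuousOn.congr (f := fun x => (permEnd γ w f).1 (permAct w x)) ?_
      fun x hx => propagation_of_antitone γ f hx
    exact ((contDiff_coe _).continuous.comp (contDiff_permAct w).continuous).continuousOn

theorem propagation_mem_cbFun (γ : ℝ) (f : smoothFun n) : propagation γ f.1 ∈ cbFun n := by
  refine ⟨continuous_propagation γ f, fun w => ?_⟩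
  refine ContDiffOn.congr (f := fun x => (permEnd γ w⁻¹ f).1 (permAct w⁻¹ x)) ?_ fun x hx => ?_
  · exact ((contDiff_coe _).comp (contDiff_permAct w⁻¹)).contDiffOn
  · rw [coe_permEnd]
    exact propagation_eq γ _ (by simpa using hx)

theorem propagation_add (γ : ℝ) (f g : smoothFun n) :
    propagation γ (f + g).1 = propagation γ f.1 + propagation γ g.1 := by
  funext x
  simp only [propagation, Pi.add_apply, ← coe_permEnd, map_add]
  rfl

theorem propagation_smul (γ : ℝ) (c : ℂ) (f : smoothFun n) :
    propagation γ (c • f).1 = c • propagation γ f.1 := by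
  funext x
  simp only [propagation, Pi.smul_apply, ← coe_permEnd, map_smul]
  rfl

/-- Only `x_a` has to be distinct from the others; the remaining coordinates may coincide, because
closed chambers suffice. -/
theorem eventually_antitone_update {x : Fin n → ℝ} (hx : Antitone x) (a : Fin n)
    (ha : ∀ b, b ≠ a → x b ≠ x a) :
    ∀ᶠ y in nhds (x a), Antitone (Function.update x a y) := by
  simp only [Antitone, Filter.eventually_all]
  intro i j hij
  rcases eq_or_ne i a with rfl | hi <;> rcases eq_or_ne j i with rfl | hj
  · simp
  · filter_upwards [lt_mem_nhds (lt_of_le_of_ne (hx hij) (ha j hj))] with y hy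
    simpa [hj] using hy.le
  · simp
  · rcases eq_or_ne j a with rfl | hja
    · filter_upwards [gt_mem_nhds (lt_of_le_of_ne (hx hij) (ha i hi).symm)] with y hy
      simpa [hi] using hy.le
    · simpa [hi, hja] using hx hij

/-- The partial derivatives of `P^γ_{(n)} f` away from the walls. -/
theorem hasDerivAt_propagation_update (γ : ℝ) (f : smoothFun n) {x : Fin n → ℝ} (a : Fin n)
    (ha : ∀ b, b ≠ a → x b ≠ x a) :
    HasDerivAt (fun y => propagation γ f.1 (Function.update x a y))
      (propagation γ (partialEnd a f).1 x +
        γ * ∑ b, ((if b < a then 1 else 0) - (if x a < x b then 1 else 0) : ℂ) *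
          propagation γ f.1 (permAct (Equiv.swap a b) x)) (x a) := by
  set w := sortPerm x with hw
  set z := permAct w x with hz
  have hanti : Antitone z := antitone_sortPerm x
  have hza : ∀ b, z (w b) = x b := permAct_apply_apply w x
  set g := permEnd γ w f with hg
  have hev : (fun y => propagation γ f.1 (Function.update x a y)) =ᶠ[nhds (x a)]
      fun y => g.1 (Function.update z (w a) y) := by
    have h1 := eventually_antitone_update hanti (w a) (fun c hc => by
      have h2 : c = w (w⁻¹ c) := by simp
      rw [h2, hza, hza]
      exact ha _ fun h3 => hc (by rw [h2, h3]))
    rw [hza] at h1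
    filter_upwards [h1] with y hy
    rw [← permAct_update] at hy ⊢
    exact propagation_of_antitone γ f hy
  refine HasDerivAt.congr_of_eventuallyEq ?_ hev
  have hup : Function.update z (w a) (x a) = z := by
    rw [← hza a, Function.update_eq_self]
  have h3 : HasDerivAt (fun y => g.1 (Function.update z (w a) y)) _ (x a) :=
    HasFDerivAt.comp_hasDerivAt (l := g.1) (x a)
      (differentiable_coe g (Function.update z (w a) (x a))).hasFDerivAt
      (hasDerivAt_update z (w a) (x a))
  refine h3.congr_deriv (Eq.symm ?_)
  rw [hup, ← partialEnd_apply, hg, ← Module.End.mul_apply, partialEnd_mul_permEnd]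
  simp only [LinearMap.add_apply, LinearMap.smul_apply, LinearMap.sum_apply, Submodule.coe_add,
    Pi.add_apply, Submodule.coe_smul, Pi.smul_apply, AddSubmonoidClass.coe_finsetSum,
    Finset.sum_apply, smul_eq_mul, Module.End.mul_apply]
  congr 1
  · exact propagation_of_antitone γ _ hanti
  · congr 1
    refine Finset.sum_congr rfl fun b _ => ?_
    congr 1
    · have hlt : w b < w a ↔ x a < x b := by
        constructor
        · intro h
          have h4 := hanti h.le
          rw [hza, hza] at h4
          rcases eq_or_ne b a with rfl | hb
          · exact absurd h (lt_irrefl _)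
          · exact lt_of_le_of_ne h4 (ha b hb).symm
        · intro h
          by_contra! h4
          have h5 := hanti h4
          rw [hza, hza] at h5
          exact absurd h (not_lt.2 h5)
      simp only [inversionCoeff, hlt]
    -- The swapped point is sorted to the same `z` by `w (a b)`, so the terms of the commutation
    -- relation are values of the propagated function itself.
    · have h6 : permAct (w * Equiv.swap a b) (permAct (Equiv.swap a b) x) = z := by
        rw [← permAct_mul, mul_assoc, Equiv.swap_mul_self, mul_one]
      rw [propagation_of_antitone γ f (w := w * Equiv.swap a b) (by rwa [h6]), h6]

end Propagation

/-! ### The added particle -/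

section EmptyCreation

variable {N : ℕ}

theorem shiftLabel_injective (ε : Sgn) : Function.Injective (shiftLabel (N := N) ε) := by
  cases ε
  · exact Fin.succ_injective N
  · exact Fin.castSucc_injective N

theorem shiftLabel_ne_newLabel (ε : Sgn) (k : Fin N) : shiftLabel ε k ≠ newLabel N ε := by
  cases ε
  · exact Fin.succ_ne_zero k
  · exact Fin.castSucc_ne_last k

theorem label_cases (ε : Sgn) (a : Fin (N + 1)) :
    a = newLabel N ε ∨ ∃ k, a = shiftLabel ε k := by
  cases ε
  · exact Fin.eq_zero_or_eq_succ a
  · exact (Fin.eq_castSucc_or_eq_last a).symm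

theorem sum_labels (ε : Sgn) (g : Fin (N + 1) → ℂ) :
    ∑ a, g a = g (newLabel N ε) + ∑ k, g (shiftLabel ε k) := by
  cases ε
  · exact Fin.sum_univ_succ g
  · rw [Fin.sum_univ_castSucc, add_comm]; rfl

theorem emptyCreation_apply (ε : Sgn) (μ : ℂ) (f : (Fin N → ℝ) → ℂ) (x : Fin (N + 1) → ℝ) :
    emptyCreation ε μ f x =
      Complex.exp (Complex.I * μ * (x (newLabel N ε) : ℂ)) * f (fun k => x (shiftLabel ε k)) := by
  cases ε
  · exact emptyCreation_plus μ f x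
  · exact emptyCreation_minus μ f x

theorem contDiff_emptyCreation (ε : Sgn) (μ : ℂ) {f : (Fin N → ℝ) → ℂ} (hf : ContDiff ℝ ∞ f) :
    ContDiff ℝ ∞ (emptyCreation ε μ f) := by
  rw [funext (emptyCreation_apply ε μ f)]
  refine ContDiff.mul (ContDiff.cexp (contDiff_const.mul ?_))
    (hf.comp (contDiff_pi.2 fun k => contDiff_apply ℝ ℝ _))
  exact Complex.ofRealCLM.contDiff.comp (contDiff_apply ℝ ℝ _)

/-- `ê^ε_{μ;∅}` as a map between spaces of smooth functions. -/
def emptyCreationSmooth (ε : Sgn) (μ : ℂ) (f : smoothFun N) : smoothFun (N + 1) :=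
  ⟨emptyCreation ε μ f, contDiff_emptyCreation ε μ (contDiff_coe f)⟩

/-- `∂_{new} ê^ε_{μ;∅} f = iμ ê^ε_{μ;∅} f`. -/
theorem partialEnd_emptyCreationSmooth (ε : Sgn) (μ : ℂ) (f : smoothFun N) :
    partialEnd (newLabel N ε) (emptyCreationSmooth ε μ f) =
      (Complex.I * μ) • emptyCreationSmooth ε μ f := by
  ext x
  set a := newLabel N ε with ha
  have h1 : HasDerivAt (fun y : ℝ => (emptyCreationSmooth ε μ f).1 (Function.update x a y))
      (fderiv ℝ (emptyCreationSmooth ε μ f).1 x (Pi.single a 1)) (x a) := by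
    have h := HasFDerivAt.comp_hasDerivAt (l := (emptyCreationSmooth ε μ f).1) (x a)
      (differentiable_coe (emptyCreationSmooth ε μ f) (Function.update x a (x a))).hasFDerivAt
      (hasDerivAt_update x a (x a))
    rw [Function.update_eq_self] at h
    exact h
  have h2 : (fun y : ℝ => (emptyCreationSmooth ε μ f).1 (Function.update x a y)) = fun y : ℝ =>
      Complex.exp (Complex.I * μ * (y : ℂ)) * f.1 (fun k => x (shiftLabel ε k)) := by
    funext y
    refine (emptyCreation_apply ε μ f.1 _).trans ?_
    simp [← ha, ha ▸ shiftLabel_ne_newLabel ε]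
  have h3 : HasDerivAt (fun y : ℝ =>
      Complex.exp (Complex.I * μ * (y : ℂ)) * f.1 (fun k => x (shiftLabel ε k)))
      ((Complex.exp (Complex.I * μ * (x a : ℂ)) * (Complex.I * μ * 1)) *
        f.1 (fun k => x (shiftLabel ε k))) (x a) :=
    ((Complex.ofRealCLM.hasDerivAt.const_mul (Complex.I * μ)).cexp).mul_const _
  rw [h2] at h1
  rw [partialEnd_apply, h1.unique h3]
  change _ = (Complex.I * μ) * emptyCreation ε μ f.1 x
  rw [emptyCreation_apply]
  ring

/-- The relabelling of simple transpositions. -/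
def liftIndex (ε : Sgn) (j : SimpleIndex N) : SimpleIndex (N + 1) :=
  match ε with
  | .plus => ⟨j.1 + 1, Nat.succ_lt_succ j.2⟩
  | .minus => ⟨j.1, Nat.lt_succ_of_lt j.2⟩

theorem liftIndex_fst (ε : Sgn) (j : SimpleIndex N) :
    (liftIndex ε j).fst = shiftLabel ε j.fst := by
  cases ε <;> rfl

theorem liftIndex_snd (ε : Sgn) (j : SimpleIndex N) :
    (liftIndex ε j).snd = shiftLabel ε j.snd := by
  cases ε <;> rfl

theorem wordPerm_lift_shiftLabel (ε : Sgn) (l : List (SimpleIndex N)) (k : Fin N) :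
    wordPerm (l.map (liftIndex ε)) (shiftLabel ε k) = shiftLabel ε (wordPerm l k) := by
  induction l with
  | nil => rfl
  | cons j l ih =>
    rw [List.map_cons, wordPerm_cons, wordPerm_cons, Equiv.Perm.mul_apply, Equiv.Perm.mul_apply,
      ih, simpleSwap, simpleSwap, liftIndex_fst, liftIndex_snd,
      (shiftLabel_injective ε).swap_apply]

theorem wordPerm_lift_newLabel (ε : Sgn) (l : List (SimpleIndex N)) :
    wordPerm (l.map (liftIndex ε)) (newLabel N ε) = newLabel N ε := by
  induction l with
  | nil => rfl
  | cons j l ih =>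
    rw [List.map_cons, wordPerm_cons, Equiv.Perm.mul_apply, ih, simpleSwap, liftIndex_fst,
      liftIndex_snd]
    exact Equiv.swap_apply_of_ne_of_ne (shiftLabel_ne_newLabel ε _).symm
      (shiftLabel_ne_newLabel ε _).symm

theorem permAct_lift_shiftLabel (ε : Sgn) (l : List (SimpleIndex N)) (x : Fin (N + 1) → ℝ)
    (k : Fin N) : permAct (wordPerm (l.map (liftIndex ε))) x (shiftLabel ε k) =
      permAct (wordPerm l) (fun k => x (shiftLabel ε k)) k := by
  have h : shiftLabel ε k = wordPerm (l.map (liftIndex ε))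
      (shiftLabel ε ((wordPerm l)⁻¹ k)) := by
    rw [wordPerm_lift_shiftLabel]; simp
  rw [h, permAct_apply_apply]
  rfl

theorem permAct_lift_newLabel (ε : Sgn) (l : List (SimpleIndex N)) (x : Fin (N + 1) → ℝ) :
    permAct (wordPerm (l.map (liftIndex ε))) x (newLabel N ε) = x (newLabel N ε) := by
  conv_lhs => rw [← wordPerm_lift_newLabel ε l]
  rw [permAct_apply_apply]

/-- A lifted simple transposition and its line of integration leave `x_new` fixed, so the
exponential factors out. -/
theorem integralReflection_emptyCreation (γ : ℝ) (ε : Sgn) (μ : ℂ) (j : SimpleIndex N)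
    (f : (Fin N → ℝ) → ℂ) :
    integralReflection γ (liftIndex ε j) (emptyCreation ε μ f) =
      emptyCreation ε μ (integralReflection γ j f) := by
  funext x
  rw [emptyCreation_apply, integralReflection, integralReflection, emptyCreation_apply]
  have h1 := permAct_lift_newLabel ε [j] x
  have h2 := funext (permAct_lift_shiftLabel ε [j] x)
  simp only [List.map_cons, List.map_nil, wordPerm_cons, wordPerm_nil, mul_one] at h1 h2
  rw [simpleSwap_inv, simpleSwap_inv, h1, h2, mul_add, integralOp, integralOp, mul_left_comm,
    ← intervalIntegral.integral_const_mul (Complex.exp _), liftIndex_fst, liftIndex_snd]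
  congr 1
  refine congrArg (fun t : ℂ => (γ : ℂ) * t)
    (intervalIntegral.integral_congr fun y _ => ?_)
  simp only [emptyCreation_apply]
  congr 2
  · simp [(shiftLabel_ne_newLabel ε _).symm]
  · funext k
    simp [Pi.single_apply, (shiftLabel_injective ε).eq_iff]

theorem wordEnd_emptyCreationSmooth (γ : ℝ) (ε : Sgn) (μ : ℂ) (l : List (SimpleIndex N))
    (f : smoothFun N) : wordEnd γ (l.map (liftIndex ε)) (emptyCreationSmooth ε μ f) =
      emptyCreationSmooth ε μ (wordEnd γ l f) := by
  induction l with
  | nil => rfl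
  | cons j l ih =>
    rw [List.map_cons, wordEnd_cons, wordEnd_cons, Module.End.mul_apply, Module.End.mul_apply, ih]
    exact Subtype.ext (integralReflection_emptyCreation γ ε μ j _)

/-- The coordinate of the added particle is the largest one (`ε = +`) or the smallest one
(`ε = -`). -/
def NewExtreme (ε : Sgn) (x : Fin (N + 1) → ℝ) : Prop :=
  match ε with
  | .plus => ∀ k : Fin N, x k.succ ≤ x 0
  | .minus => ∀ k : Fin N, x (Fin.last N) ≤ x k.castSucc

theorem NewExtreme.antitone {ε : Sgn} {x : Fin (N + 1) → ℝ} (hx : NewExtreme ε x)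
    (h : Antitone fun k => x (shiftLabel ε k)) : Antitone x := by
  intro i j hij
  cases ε with
  | plus =>
    induction i using Fin.cases with
    | zero =>
      induction j using Fin.cases with
      | zero => exact le_rfl
      | succ j => exact hx j
    | succ i =>
      induction j using Fin.cases with
      | zero => exact absurd hij (by simp)
      | succ j => exact h (Fin.succ_le_succ_iff.1 hij)
  | minus =>
    induction j using Fin.lastCases with
    | last =>
      induction i using Fin.lastCases with
      | last => exact le_rfl
      | cast i => exact hx i
    | cast j =>
      induction i using Fin.lastCases with
      | last => exact absurd hij (by simp)
      | cast i => exact h (Fin.castSucc_le_castSucc_iff.1 hij)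

/-- Such an `x` is sorted by permuting the old coordinates alone, and lifted words commute with
`ê^ε_{μ;∅}`. Ties are allowed, since the chamber formula holds on closures. -/
theorem propagation_emptyCreation_of_extreme (γ : ℝ) (ε : Sgn) (μ : ℂ) (f : smoothFun N)
    {x : Fin (N + 1) → ℝ} (hx : NewExtreme ε x) :
    propagation γ (emptyCreation ε μ f.1) x =
      Complex.exp (Complex.I * μ * (x (newLabel N ε) : ℂ)) *
        propagation γ f.1 (fun k => x (shiftLabel ε k)) := by
  set x' : Fin N → ℝ := fun k => x (shiftLabel ε k) with hx'
  obtain ⟨l, hl⟩ := exists_wordPerm_eq (sortPerm x')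
  have hanti : Antitone (permAct (wordPerm l) x') := hl ▸ antitone_sortPerm x'
  have hnew := permAct_lift_newLabel ε l x
  have hshift := permAct_lift_shiftLabel ε l x
  have hext : NewExtreme ε (permAct (wordPerm (l.map (liftIndex ε))) x) := by
    cases ε with
    | plus => exact fun k => (hshift k).trans_le ((hx _).trans_eq hnew.symm)
    | minus => exact fun k => hnew.trans_le ((hx _).trans_eq (hshift k).symm)
  have hanti' : Antitone (permAct (wordPerm (l.map (liftIndex ε))) x) := by
    refine hext.antitone ?_
    rw [funext hshift]
    exact hanti
  have h1 := propagation_of_antitone γ (emptyCreationSmooth ε μ f) hanti'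
  rw [permEnd_wordPerm, wordEnd_emptyCreationSmooth] at h1
  refine h1.trans ((emptyCreation_apply ε μ _ _).trans ?_)
  rw [hnew, funext hshift, propagation_of_antitone γ f hanti, permEnd_wordPerm]

end EmptyCreation

/-! ### The integral recursion -/

section Recursion

variable {N : ℕ}

/-- The point `x` with the coordinate of the added particle replaced by `y`, and then interchanged
with the `k`-th one of the others. -/
def exchangePoint (ε : Sgn) (k : Fin N) (x : Fin (N + 1) → ℝ) (y : ℝ) : Fin (N + 1) → ℝ :=
  permAct (Equiv.swap (newLabel N ε) (shiftLabel ε k)) (Function.update x (newLabel N ε) y)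

/-- The lower limit of integration: `p` for `ε = +`, `q` for `ε = -`. -/
def lowerLimit (ε : Sgn) (p q : ℝ) : ℝ :=
  match ε with
  | .plus => p
  | .minus => q

/-- The upper limit of integration: `q` for `ε = +`, `p` for `ε = -`. -/
def upperLimit (ε : Sgn) (p q : ℝ) : ℝ :=
  match ε with
  | .plus => q
  | .minus => p

open Classical in
/-- The integral over the positions at which the added particle interchanges with the `k`-th one of
the others. -/
def exchangeIntegral (ε : Sgn) (μ : ℂ) (k : Fin N) (G : (Fin (N + 1) → ℝ) → ℂ)
    (x : Fin (N + 1) → ℝ) : ℂ :=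
  if lowerLimit ε (x (newLabel N ε)) (x (shiftLabel ε k)) <
      upperLimit ε (x (newLabel N ε)) (x (shiftLabel ε k)) then
    ∫ y in (lowerLimit ε (x (newLabel N ε)) (x (shiftLabel ε k)))..
        (upperLimit ε (x (newLabel N ε)) (x (shiftLabel ε k))),
      Complex.exp (Complex.I * μ * ((x (newLabel N ε) : ℂ) - (y : ℂ))) *
        G (exchangePoint ε k x y)
  else 0

theorem intervalIntegrable_ite_le {K : ℝ → ℂ} (q a b : ℝ) (hK : Continuous K) :
    IntervalIntegrable (fun y => (if y ≤ q then 1 else 0) * K y) MeasureTheory.volume a b := by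
  have h : (fun y => (if y ≤ q then 1 else 0) * K y) = (Set.Iic q).indicator K := by
    funext y
    simp [Set.indicator_apply]
  rw [h, intervalIntegrable_iff]
  exact (intervalIntegrable_iff.1 (hK.intervalIntegrable a b)).indicator measurableSet_Iic

theorem integral_ite_le {K : ℝ → ℂ} (hK : Continuous K) {p q M : ℝ} (hp : p ≤ M) (hq : q ≤ M) :
    ∫ y in p..M, (if y ≤ q then 1 else 0) * K y = if p < q then ∫ y in p..q, K y else 0 := by
  split_ifs with h
  · rw [← intervalIntegral.integral_add_adjacent_intervals (b := q)
      (intervalIntegrable_ite_le q p q hK) (intervalIntegrable_ite_le q q M hK),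
      intervalIntegral.integral_congr_Ioo_of_le (a := p) (b := q) (g := K) h.le,
      intervalIntegral.integral_congr_Ioo_of_le (a := q) (b := M) (g := fun _ => 0) hq]
    · simp
    · intro y hy
      simp [not_le.2 hy.1]
    · intro y hy
      simp [hy.2.le]
  · rw [intervalIntegral.integral_congr_Ioo_of_le (g := fun _ => 0) hp]
    · simp
    · intro y hy
      simp [(not_lt.1 h).trans_lt hy.1]

theorem integral_one_sub_ite_le {K : ℝ → ℂ} (hK : Continuous K) {p q M : ℝ} (hp : M ≤ p)
    (hq : M ≤ q) : ∫ y in M..p, (1 - if y ≤ q then 1 else 0) * K y =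
      if q < p then ∫ y in q..p, K y else 0 := by
  have h0 : ∀ a b, IntervalIntegrable (fun y => (1 - if y ≤ q then 1 else 0) * K y)
      MeasureTheory.volume a b := by
    intro a b
    have h := (hK.intervalIntegrable a b (μ := MeasureTheory.volume)).sub
      (intervalIntegrable_ite_le q a b hK)
    simpa only [sub_mul, one_mul] using h
  split_ifs with h
  · rw [← intervalIntegral.integral_add_adjacent_intervals (b := q) (h0 _ _) (h0 _ _),
      intervalIntegral.integral_congr_Ioo_of_le (a := q) (b := p) (g := K) h.le,
      intervalIntegral.integral_congr_Ioo_of_le (a := M) (b := q) (g := fun _ => 0) hq]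
    · simp
    · intro y hy
      simp [hy.2.le]
    · intro y hy
      simp [not_le.2 hy.1]
  · rw [intervalIntegral.integral_congr_Ioo_of_le (g := fun _ => 0) hp]
    · simp
    · intro y hy
      simp [hy.2.le.trans (not_lt.1 h)]

theorem continuous_exchangePoint (ε : Sgn) (k : Fin N) (x : Fin (N + 1) → ℝ) :
    Continuous (exchangePoint ε k x) :=
  (contDiff_permAct _).continuous.comp (continuous_const.update _ continuous_id)

/-- On the way from the extreme position `M` to `x_new`, the coefficient is nonzero only on the
stretch beyond `x_k`. For `ε = +` it is `-1` there and the path runs downwards, for `ε = -` it is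
`+1` and the path runs upwards, so both signs come out positive. -/
theorem exp_mul_exchangeIntegral {G : (Fin (N + 1) → ℝ) → ℂ} (hG : Continuous G) (ε : Sgn)
    (μ : ℂ) (k : Fin N) (x : Fin (N + 1) → ℝ) {M : ℝ}
    (hM : NewExtreme ε (Function.update x (newLabel N ε) M))
    (hM' : lowerLimit ε (x (newLabel N ε)) M ≤ upperLimit ε (x (newLabel N ε)) M) :
    Complex.exp (Complex.I * μ * (x (newLabel N ε) : ℂ)) *
      ∫ y in M..x (newLabel N ε),
        ((if shiftLabel ε k < newLabel N ε then 1 else 0) -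
          (if y ≤ x (shiftLabel ε k) then 1 else 0) : ℂ) *
          (Complex.exp (-(Complex.I * μ * (y : ℂ))) * G (exchangePoint ε k x y)) =
      exchangeIntegral ε μ k G x := by
  have hK : Continuous fun y : ℝ =>
      Complex.exp (-(Complex.I * μ * (y : ℂ))) * G (exchangePoint ε k x y) :=
    (by fun_prop : Continuous fun y : ℝ => Complex.exp (-(Complex.I * μ * (y : ℂ)))).mul
      (hG.comp (continuous_exchangePoint ε k x))
  have hexp : ∀ p q : ℝ, ∫ y in p..q,
      Complex.exp (Complex.I * μ * ((x (newLabel N ε) : ℂ) - (y : ℂ))) *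
        G (exchangePoint ε k x y) = Complex.exp (Complex.I * μ * (x (newLabel N ε) : ℂ)) *
        ∫ y in p..q, Complex.exp (-(Complex.I * μ * (y : ℂ))) * G (exchangePoint ε k x y) := by
    intro p q
    rw [← intervalIntegral.integral_const_mul]
    refine intervalIntegral.integral_congr fun y _ => ?_
    rw [← mul_assoc, ← Complex.exp_add]
    congr 2
    ring
  rw [exchangeIntegral, hexp]
  cases ε with
  | plus =>
    have hMk : x (shiftLabel .plus k) ≤ M := by simpa [newLabel, shiftLabel] using hM k
    have h0 : ¬ shiftLabel .plus k < newLabel N .plus := Fin.not_lt_zero _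
    simp only [h0, if_false, zero_sub, neg_mul, intervalIntegral.integral_neg]
    rw [← intervalIntegral.integral_symm, integral_ite_le hK (show x (newLabel N .plus) ≤ M from hM') hMk]
    rw [mul_ite, mul_zero]
    rfl
  | minus =>
    have hMk : M ≤ x (shiftLabel .minus k) := by
      simpa [newLabel, shiftLabel, (Fin.castSucc_lt_last k).ne] using hM k
    have h0 : shiftLabel .minus k < newLabel N .minus := Fin.castSucc_lt_last k
    simp only [h0, if_true]
    rw [integral_one_sub_ite_le hK (show M ≤ x (newLabel N .minus) from hM') hMk]
    rw [mul_ite, mul_zero]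
    rfl

theorem exists_newExtreme_update (ε : Sgn) (x : Fin (N + 1) → ℝ) :
    ∃ M : ℝ, NewExtreme ε (Function.update x (newLabel N ε) M) ∧
      lowerLimit ε (x (newLabel N ε)) M ≤ upperLimit ε (x (newLabel N ε)) M := by
  cases ε with
  | plus =>
    obtain ⟨M, hM⟩ := (Set.finite_range x).bddAbove
    refine ⟨M, fun k => ?_, hM ⟨_, rfl⟩⟩
    simpa [newLabel] using hM ⟨k.succ, rfl⟩
  | minus =>
    obtain ⟨M, hM⟩ := (Set.finite_range x).bddBelow
    refine ⟨M, fun k => ?_, hM ⟨_, rfl⟩⟩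
    simpa [newLabel, (Fin.castSucc_lt_last k).ne] using hM ⟨k.castSucc, rfl⟩

/-- The derivative of the exponential cancels the term `P^γ ∂_new ê f = iμ P^γ ê f`, which leaves
the exchange terms. -/
theorem hasDerivAt_exp_mul_propagation (γ : ℝ) (ε : Sgn) (μ : ℂ) (f : smoothFun N)
    (x : Fin (N + 1) → ℝ) {y : ℝ} (hy : ∀ k, x (shiftLabel ε k) ≠ y) :
    HasDerivAt (fun y : ℝ => Complex.exp (-(Complex.I * μ * (y : ℂ))) *
        propagation γ (emptyCreation ε μ f.1) (Function.update x (newLabel N ε) y))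
      (γ * ∑ k, ((if shiftLabel ε k < newLabel N ε then 1 else 0) -
          (if y ≤ x (shiftLabel ε k) then 1 else 0) : ℂ) *
        (Complex.exp (-(Complex.I * μ * (y : ℂ))) *
          propagation γ (emptyCreation ε μ f.1) (exchangePoint ε k x y))) y := by
  set a := newLabel N ε with ha
  have hne : ∀ k, shiftLabel ε k ≠ a := shiftLabel_ne_newLabel ε
  have h1 := hasDerivAt_propagation_update γ (emptyCreationSmooth ε μ f)
    (x := Function.update x a y) a (by
      intro b hb
      obtain ⟨k, rfl⟩ := (label_cases ε b).resolve_left hb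
      simpa [hb] using hy k)
  simp only [Function.update_idem, Function.update_self] at h1
  have h2 : HasDerivAt (fun y : ℝ => Complex.exp (-(Complex.I * μ * (y : ℂ))))
      (Complex.exp (-(Complex.I * μ * (y : ℂ))) * -(Complex.I * μ * 1)) y :=
    (Complex.ofRealCLM.hasDerivAt.const_mul (Complex.I * μ)).neg.cexp
  refine (h2.mul h1).congr_deriv ?_
  rw [ha, partialEnd_emptyCreationSmooth, ← ha, propagation_smul, sum_labels ε, ← ha,
    Function.update_self, if_neg (lt_irrefl a), if_neg (lt_irrefl y), sub_self, zero_mul, zero_add]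
  have h3 : ∀ k, ((if shiftLabel ε k < a then 1 else 0) -
        (if y < Function.update x a y (shiftLabel ε k) then 1 else 0) : ℂ) *
        propagation γ (emptyCreationSmooth ε μ f).1
          (permAct (Equiv.swap a (shiftLabel ε k)) (Function.update x a y)) =
      ((if shiftLabel ε k < a then 1 else 0) - (if y ≤ x (shiftLabel ε k) then 1 else 0) : ℂ) *
        propagation γ (emptyCreation ε μ f.1) (exchangePoint ε k x y) := by
    intro k
    have hiff : y < Function.update x a y (shiftLabel ε k) ↔ y ≤ x (shiftLabel ε k) := by
      rw [Function.update_of_ne (hne k)]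
      exact ⟨le_of_lt, fun h => lt_of_le_of_ne h (hy k).symm⟩
    simp only [hiff]
    rfl
  simp only [h3, Pi.smul_apply, smul_eq_mul]
  have h4 : ∀ k, ((if shiftLabel ε k < a then 1 else 0) -
        (if y ≤ x (shiftLabel ε k) then 1 else 0) : ℂ) *
        (Complex.exp (-(Complex.I * μ * (y : ℂ))) *
          propagation γ (emptyCreation ε μ f.1) (exchangePoint ε k x y)) =
      Complex.exp (-(Complex.I * μ * (y : ℂ))) *
      (((if shiftLabel ε k < a then 1 else 0) - (if y ≤ x (shiftLabel ε k) then 1 else 0) : ℂ) *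
          propagation γ (emptyCreation ε μ f.1) (exchangePoint ε k x y)) := fun k => by ring
  simp only [h4, ← Finset.mul_sum]
  ring

theorem propagation_emptyCreation_eq (γ : ℝ) (ε : Sgn) (μ : ℂ) (f : smoothFun N)
    (x : Fin (N + 1) → ℝ) :
    propagation γ (emptyCreation ε μ f.1) x =
      Complex.exp (Complex.I * μ * (x (newLabel N ε) : ℂ)) *
        propagation γ f.1 (fun k => x (shiftLabel ε k)) +
      γ * ∑ k, exchangeIntegral ε μ k (propagation γ (emptyCreation ε μ f.1)) x := by
  have hG : Continuous (propagation γ (emptyCreation ε μ f.1)) :=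
    continuous_propagation γ (emptyCreationSmooth ε μ f)
  obtain ⟨M, hM, hM'⟩ := exists_newExtreme_update ε x
  simp only [← exp_mul_exchangeIntegral hG ε μ _ x hM hM']
  have hP := propagation_emptyCreation_of_extreme γ ε μ f hM
  set G := propagation γ (emptyCreation ε μ f.1) with hGdef
  set a := newLabel N ε with ha
  have hne : ∀ k, shiftLabel ε k ≠ a := shiftLabel_ne_newLabel ε
  have hint : ∀ k, IntervalIntegrable (fun y : ℝ =>
      ((if shiftLabel ε k < a then 1 else 0) - (if y ≤ x (shiftLabel ε k) then 1 else 0) : ℂ) *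
        (Complex.exp (-(Complex.I * μ * (y : ℂ))) * G (exchangePoint ε k x y)))
      MeasureTheory.volume M (x a) := by
    intro k
    have hK : Continuous fun y : ℝ =>
        Complex.exp (-(Complex.I * μ * (y : ℂ))) * G (exchangePoint ε k x y) :=
      (by fun_prop : Continuous fun y : ℝ => Complex.exp (-(Complex.I * μ * (y : ℂ)))).mul
        (hG.comp (continuous_exchangePoint ε k x))
    simp only [sub_mul]
    exact ((continuous_const.mul hK).intervalIntegrable _ _).sub (intervalIntegrable_ite_le _ _ _ hK)
  have hsum : IntervalIntegrable (fun y => (γ : ℂ) *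
      ∑ k, ((if shiftLabel ε k < a then 1 else 0) -
          (if y ≤ x (shiftLabel ε k) then 1 else 0) : ℂ) *
        (Complex.exp (-(Complex.I * μ * (y : ℂ))) * G (exchangePoint ε k x y)))
      MeasureTheory.volume M (x a) := by
    refine IntervalIntegrable.const_mul ?_ _
    exact ⟨MeasureTheory.integrable_finsetSum _ fun k _ => (hint k).1,
      MeasureTheory.integrable_finsetSum _ fun k _ => (hint k).2⟩
  have hcont : Continuous fun y : ℝ =>
      Complex.exp (-(Complex.I * μ * (y : ℂ))) * G (Function.update x a y) :=
    (by fun_prop : Continuous fun y : ℝ => Complex.exp (-(Complex.I * μ * (y : ℂ)))).mul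
      (hG.comp (continuous_const.update a continuous_id))
  -- Differentiability may fail at the finitely many `y = x_k`; continuity across these points is
  -- enough for the fundamental theorem.
  have hftc := MeasureTheory.integral_eq_of_hasDerivAt_off_countable _ _
    (Set.finite_range fun k => x (shiftLabel ε k)).countable (hcont.continuousOn)
    (fun y hy => hasDerivAt_exp_mul_propagation γ ε μ f x fun k hk => hy.2 ⟨k, hk⟩) hsum
  rw [intervalIntegral.integral_const_mul,
    intervalIntegral.integral_finsetSum (fun k _ => hint k), Function.update_eq_self, hP] at hftc
  rw [← Finset.mul_sum, mul_left_comm, hftc]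
  simp only [Function.update_self, Function.update_of_ne (hne _)]
  have e1 : Complex.exp (Complex.I * μ * (x a : ℂ)) *
      Complex.exp (-(Complex.I * μ * (x a : ℂ))) = 1 := by
    rw [← Complex.exp_add, add_neg_cancel, Complex.exp_zero]
  have e2 : Complex.exp (-(Complex.I * μ * (M : ℂ))) *
      Complex.exp (Complex.I * μ * (M : ℂ)) = 1 := by
    rw [← Complex.exp_add, neg_add_cancel, Complex.exp_zero]
  rw [← mul_assoc (Complex.exp (-(Complex.I * μ * (M : ℂ)))), e2, mul_sub, ← mul_assoc, e1]
  ring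

end Recursion

/-! ### Iterated integrals -/

section IterIntegral

theorem continuous_cons {X : Type*} [TopologicalSpace X] {n : ℕ} {f : X → ℝ}
    {g : X → Fin n → ℝ} (hf : Continuous f) (hg : Continuous g) :
    Continuous fun x => Fin.cons (α := fun _ : Fin (n + 1) => ℝ) (f x) (g x) :=
  Continuous.finCons (A := fun _ : Fin (n + 1) => ℝ) hf hg

theorem continuous_snoc {X : Type*} [TopologicalSpace X] {n : ℕ} {f : X → ℝ}
    {g : X → Fin n → ℝ} (hf : Continuous f) (hg : Continuous g) :
    Continuous fun x => Fin.snoc (α := fun _ : Fin (n + 1) => ℝ) (g x) (f x) :=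
  Continuous.finSnoc (A := fun _ : Fin (n + 1) => ℝ) hg hf

theorem iterIntegral_succ (n : ℕ) (a b : Fin (n + 1) → ℝ) (F : (Fin (n + 1) → ℝ) → ℂ) :
    iterIntegral (n + 1) a b F = ∫ y in (a 0)..(b 0),
      iterIntegral n (Fin.tail a) (Fin.tail b)
        (fun ys => F (Fin.cons (α := fun _ => ℝ) y ys)) := rfl

theorem iterIntegral_const_mul (n : ℕ) (a b : Fin n → ℝ) (c : ℂ) (F : (Fin n → ℝ) → ℂ) :
    iterIntegral n a b (fun y => c * F y) = c * iterIntegral n a b F := by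
  induction n with
  | zero => rfl
  | succ n ih =>
    simp only [iterIntegral_succ, ih, intervalIntegral.integral_const_mul]

/-- The parameter space is arbitrary so that in the induction the outer integration variable can
join it. -/
theorem continuous_iterIntegral {X : Type*} [TopologicalSpace X] (n : ℕ) (a b : Fin n → ℝ)
    {F : X → (Fin n → ℝ) → ℂ} (hF : Continuous fun p : X × (Fin n → ℝ) => F p.1 p.2) :
    Continuous fun x => iterIntegral n a b (F x) := by
  induction n generalizing X with
  | zero => exact hF.comp (by fun_prop : Continuous fun x : X => (x, (Fin.elim0 : Fin 0 → ℝ)))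
  | succ n ih =>
    simp only [iterIntegral_succ]
    refine intervalIntegral.continuous_parametric_intervalIntegral_of_continuous' ?_ _ _
    refine ih (X := X × ℝ) (F := fun q ys => F q.1 (Fin.cons (α := fun _ => ℝ) q.2 ys)) _ _ ?_
    exact hF.comp (continuous_fst.fst.prodMk (continuous_cons continuous_fst.snd continuous_snd))

/-- The last of the iterated integrations may be performed outermost. -/
theorem iterIntegral_succ_last (n : ℕ) (a b : Fin (n + 1) → ℝ) {F : (Fin (n + 1) → ℝ) → ℂ}
    (hF : Continuous F) :
    iterIntegral (n + 1) a b F = ∫ y in (a (Fin.last n))..(b (Fin.last n)),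
      iterIntegral n (Fin.init a) (Fin.init b)
        (fun ys => F (Fin.snoc (α := fun _ => ℝ) ys y)) := by
  induction n with
  | zero =>
    rw [iterIntegral_succ]
    refine intervalIntegral.integral_congr fun y _ => ?_
    change F _ = F _
    congr 1
    funext i
    rw [Fin.fin_one_eq_zero i]
    rfl
  | succ n ih =>
    rw [iterIntegral_succ]
    have h1 : ∀ y₀ : ℝ, iterIntegral (n + 1) (Fin.tail a) (Fin.tail b)
        (fun ys => F (Fin.cons (α := fun _ => ℝ) y₀ ys)) =
        ∫ y in (a (Fin.last (n + 1)))..(b (Fin.last (n + 1))),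
          iterIntegral n (Fin.tail (Fin.init a)) (Fin.tail (Fin.init b))
            (fun ys => F (Fin.snoc (α := fun _ => ℝ) (Fin.cons (α := fun _ => ℝ) y₀ ys) y)) := by
      intro y₀
      rw [ih _ _ (F := fun ys => F (Fin.cons (α := fun _ => ℝ) y₀ ys))
        (hF.comp (continuous_cons continuous_const continuous_id))]
      simp only [Fin.cons_snoc_eq_snoc_cons]
      rfl
    simp only [h1]
    have hc : Continuous fun p : ℝ × ℝ =>
        iterIntegral n (Fin.tail (Fin.init a)) (Fin.tail (Fin.init b))
          (fun ys => F (Fin.snoc (α := fun _ => ℝ) (Fin.cons (α := fun _ => ℝ) p.1 ys) p.2)) := by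
      refine continuous_iterIntegral (X := ℝ × ℝ) n _ _
        (F := fun p ys => F (Fin.snoc (α := fun _ => ℝ) (Fin.cons (α := fun _ => ℝ) p.1 ys) p.2)) ?_
      exact hF.comp (continuous_snoc continuous_fst.snd
        (continuous_cons continuous_fst.fst continuous_snd))
    refine MeasureTheory.intervalIntegral_intervalIntegral_swap ?_
    exact (hc.continuousOn.integrableOn_compact (isCompact_uIcc.prod isCompact_uIcc)).mono_set
      (Set.prod_mono Set.uIoc_subset_uIcc Set.uIoc_subset_uIcc)

end IterIntegral

/-! ### Adjoining a label to a tuple -/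

section Tuples

variable {N n : ℕ}

theorem strictAnti_iff_succ {f : Fin (n + 2) → ℝ} :
    StrictAnti f ↔ f 1 < f 0 ∧ StrictAnti fun m : Fin (n + 1) => f m.succ := by
  rw [Fin.strictAnti_iff_succ_lt, Fin.strictAnti_iff_succ_lt, Fin.forall_fin_succ]
  rfl

theorem strictAnti_iff_castSucc {f : Fin (n + 2) → ℝ} :
    StrictAnti f ↔ f (Fin.last (n + 1)) < f (Fin.last n).castSucc ∧
      StrictAnti fun m : Fin (n + 1) => f m.castSucc := by
  rw [Fin.strictAnti_iff_succ_lt, Fin.strictAnti_iff_succ_lt, Fin.forall_fin_succ', and_comm]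
  rfl

/-- The tuple with the entry `k` adjoined at the end (`ε = +`) or at the beginning (`ε = -`). -/
def extTuple {α : Type} (ε : Sgn) (k : α) (i : Fin n → α) : Fin (n + 1) → α :=
  match ε with
  | .plus => Fin.snoc (α := fun _ => α) i k
  | .minus => Fin.cons (α := fun _ => α) k i

/-- The position of the adjoined entry. -/
def extPos (n : ℕ) : Sgn → Fin (n + 1)
  | .plus => Fin.last n
  | .minus => 0

/-- The positions of the other entries. -/
def extEmb : Sgn → Fin n → Fin (n + 1)
  | .plus => Fin.castSucc
  | .minus => Fin.succ

@[simp] theorem extTuple_extPos {α : Type} (ε : Sgn) (k : α) (i : Fin n → α) :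
    extTuple ε k i (extPos n ε) = k := by
  cases ε <;> simp [extTuple, extPos]

@[simp] theorem extTuple_extEmb {α : Type} (ε : Sgn) (k : α) (i : Fin n → α) (m : Fin n) :
    extTuple ε k i (extEmb ε m) = i m := by
  cases ε <;> simp [extTuple, extEmb]

theorem extEmb_injective (ε : Sgn) : Function.Injective (extEmb (n := n) ε) := by
  cases ε
  · exact Fin.castSucc_injective n
  · exact Fin.succ_injective n

theorem extEmb_ne_extPos (ε : Sgn) (m : Fin n) : extEmb ε m ≠ extPos n ε := by
  cases ε
  · exact Fin.castSucc_ne_last m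
  · exact Fin.succ_ne_zero m

theorem extPos_cases (ε : Sgn) (p : Fin (n + 1)) : p = extPos n ε ∨ ∃ m, p = extEmb ε m := by
  cases ε
  · exact (Fin.eq_castSucc_or_eq_last p).symm
  · exact Fin.eq_zero_or_eq_succ p

theorem prod_extTuple (ε : Sgn) (g : Fin (n + 1) → ℂ) :
    ∏ m, g m = g (extPos n ε) * ∏ m, g (extEmb ε m) := by
  cases ε
  · rw [Fin.prod_univ_castSucc, mul_comm]; rfl
  · exact Fin.prod_univ_succ g

theorem sum_extTuple {α : Type} [Fintype α] (ε : Sgn) (g : (Fin (n + 1) → α) → ℂ) :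
    ∑ i, g i = ∑ k, ∑ i, g (extTuple ε k i) := by
  rw [← Fintype.sum_prod_type']
  cases ε
  · exact ((Fin.snocEquiv fun _ => α).sum_comp g).symm
  · exact ((Fin.consEquiv fun _ => α).sum_comp g).symm

theorem continuous_extTuple (ε : Sgn) :
    Continuous fun p : ℝ × (Fin n → ℝ) => extTuple ε p.1 p.2 := by
  cases ε
  · exact continuous_snoc continuous_fst continuous_snd
  · exact continuous_cons continuous_fst continuous_snd

theorem chain_extPos (ε : Sgn) (i : Fin n → Fin N) : chain ε i (extPos n ε) = newLabel N ε := by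
  cases ε <;> simp [chain, extPos]

theorem chain_extEmb (ε : Sgn) (i : Fin n → Fin N) (m : Fin n) :
    chain ε i (extEmb ε m) = shiftLabel ε (i m) := by
  cases ε <;> simp [chain, extEmb]

/-- The adjoined label is the neighbour of the added particle in the chain, so one comparison splits
off. -/
theorem strictAnti_extTuple_iff (ε : Sgn) (k : Fin N) (i : Fin n → Fin N)
    (x : Fin (N + 1) → ℝ) :
    StrictAnti (fun m => x (chain ε (extTuple ε k i) m)) ↔
      lowerLimit ε (x (newLabel N ε)) (x (shiftLabel ε k)) <
        upperLimit ε (x (newLabel N ε)) (x (shiftLabel ε k)) ∧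
      StrictAnti fun m => x (chain ε (extTuple ε k i) (extEmb ε m)) := by
  have h1 := chain_extPos ε (extTuple ε k i)
  have h2 : chain ε (extTuple ε k i) (extEmb ε (extPos n ε)) = shiftLabel ε k := by
    rw [chain_extEmb, extTuple_extPos]
  rw [← h1, ← h2]
  cases ε
  · exact strictAnti_iff_castSucc
  · exact strictAnti_iff_succ

theorem injective_of_strictAnti (ε : Sgn) (i : Fin n → Fin N) (x : Fin (N + 1) → ℝ)
    (h : StrictAnti fun m => x (chain ε i m)) : Function.Injective i := by
  intro m m' hm
  apply extEmb_injective ε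
  apply h.injective
  simp only [chain_extEmb, hm]

theorem exchangePoint_newLabel (ε : Sgn) (k : Fin N) (x : Fin (N + 1) → ℝ) (y : ℝ) :
    exchangePoint ε k x y (newLabel N ε) = x (shiftLabel ε k) := by
  simp [exchangePoint, permAct, shiftLabel_ne_newLabel]

theorem exchangePoint_shiftLabel (ε : Sgn) (k j : Fin N) (x : Fin (N + 1) → ℝ) (y : ℝ) :
    exchangePoint ε k x y (shiftLabel ε j) = if j = k then y else x (shiftLabel ε j) := by
  split_ifs with h
  · subst h
    simp [exchangePoint, permAct]
  · have h1 : shiftLabel ε j ≠ shiftLabel ε k := fun h2 => h (shiftLabel_injective ε h2)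
    simp [exchangePoint, permAct, Equiv.swap_apply_of_ne_of_ne (shiftLabel_ne_newLabel ε j) h1,
      shiftLabel_ne_newLabel]

/-- At the exchanged point the added particle stands at `x_k`, so it takes over the place of `k` in
the chain. -/
theorem exchangePoint_chain (ε : Sgn) {k : Fin N} {i : Fin n → Fin N} (hk : ∀ m, i m ≠ k)
    (x : Fin (N + 1) → ℝ) (y : ℝ) (p : Fin (n + 1)) :
    exchangePoint ε k x y (chain ε i p) = x (chain ε (extTuple ε k i) (extEmb ε p)) := by
  rw [chain_extEmb]
  rcases extPos_cases ε p with rfl | ⟨m, rfl⟩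
  · rw [chain_extPos, exchangePoint_newLabel, extTuple_extPos]
  · rw [chain_extEmb, exchangePoint_shiftLabel, extTuple_extEmb, if_neg (hk m)]

/-- If `k` already occurs in `i`, its coordinate is now `y`, on the wrong side of the added particle
at `x_k`. Repeated labels thus contribute nothing. -/
theorem not_strictAnti_exchangePoint (ε : Sgn) {k : Fin N} {i : Fin n → Fin N} {m : Fin n}
    (hm : i m = k) {x : Fin (N + 1) → ℝ} {y : ℝ}
    (hy : y ∈ Set.Icc (lowerLimit ε (x (newLabel N ε)) (x (shiftLabel ε k)))
      (upperLimit ε (x (newLabel N ε)) (x (shiftLabel ε k)))) :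
    ¬ StrictAnti fun p => exchangePoint ε k x y (chain ε i p) := by
  intro h
  have h1 : exchangePoint ε k x y (chain ε i (extEmb ε m)) = y := by
    rw [chain_extEmb, exchangePoint_shiftLabel, if_pos hm]
  have h2 : exchangePoint ε k x y (chain ε i (extPos n ε)) = x (shiftLabel ε k) := by
    rw [chain_extPos, exchangePoint_newLabel]
  cases ε with
  | plus =>
    have h3 := h (show extEmb .plus m < extPos n .plus from Fin.castSucc_lt_last m)
    simp only [h1, h2] at h3
    exact absurd hy.2 (not_le.2 h3)
  | minus =>
    have h3 := h (show extPos n .minus < extEmb .minus m from Fin.succ_pos m)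
    simp only [h1, h2] at h3
    exact absurd hy.1 (not_le.2 h3)

theorem extend_extTuple (ε : Sgn) {k : Fin N} {i : Fin n → Fin N}
    (hinj : Function.Injective (extTuple ε k i)) (x : Fin (N + 1) → ℝ) (y : ℝ) (ys : Fin n → ℝ) :
    Function.extend (extTuple ε k i) (extTuple ε y ys) (fun j => x (shiftLabel ε j)) =
      Function.extend i ys (fun j => exchangePoint ε k x y (shiftLabel ε j)) := by
  have hi : Function.Injective i := by
    intro m m' h
    apply extEmb_injective ε
    apply hinj
    simpa using h
  have hk : ∀ m, i m ≠ k := by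
    intro m h
    apply extEmb_ne_extPos ε m
    apply hinj
    simpa using h
  funext j
  by_cases hj : ∃ m, i m = j
  · obtain ⟨m, rfl⟩ := hj
    rw [hi.extend_apply, ← extTuple_extEmb ε k i m, hinj.extend_apply, extTuple_extEmb]
  · rw [Function.extend_apply' _ _ _ hj, exchangePoint_shiftLabel]
    split_ifs with h
    · subst h
      have h1 := hinj.extend_apply (extTuple ε y ys) (fun j => x (shiftLabel ε j)) (extPos n ε)
      rwa [extTuple_extPos, extTuple_extPos] at h1
    · rw [Function.extend_apply']
      rintro ⟨p, rfl⟩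
      rcases extPos_cases ε p with rfl | ⟨m, rfl⟩
      · exact h (extTuple_extPos ε k i)
      · exact hj ⟨m, (extTuple_extEmb ε k i m).symm⟩

theorem iterIntegral_extTuple (ε : Sgn) (k : Fin N) (i : Fin n → Fin N) (x : Fin (N + 1) → ℝ)
    {F : (Fin (n + 1) → ℝ) → ℂ} (hF : Continuous F) :
    iterIntegral (n + 1) (fun m => x (chain ε (extTuple ε k i) m.succ))
        (fun m => x (chain ε (extTuple ε k i) m.castSucc)) F =
      ∫ y in (lowerLimit ε (x (newLabel N ε)) (x (shiftLabel ε k)))..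
          (upperLimit ε (x (newLabel N ε)) (x (shiftLabel ε k))),
        iterIntegral n (fun m => x (chain ε (extTuple ε k i) (extEmb ε m.succ)))
          (fun m => x (chain ε (extTuple ε k i) (extEmb ε m.castSucc)))
          (fun ys => F (extTuple ε y ys)) := by
  have h1 := chain_extPos ε (extTuple ε k i)
  have h2 : chain ε (extTuple ε k i) (extEmb ε (extPos n ε)) = shiftLabel ε k := by
    rw [chain_extEmb, extTuple_extPos]
  rw [← h1, ← h2]
  cases ε
  · exact iterIntegral_succ_last n _ _ hF
  · exact iterIntegral_succ n _ _ F

end Tuples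

/-! ### The integral recursion for the creation operators -/

section Creation

variable {N n : ℕ}

/-- The integrand of the elementary creation operators. -/
def creationIntegrand (μ : ℂ) (i : Fin n → Fin N) (h : (Fin N → ℝ) → ℂ) (x' : Fin N → ℝ)
    (y : Fin n → ℝ) : ℂ :=
  (∏ m : Fin n, Complex.exp (Complex.I * μ * ((x' (i m) : ℂ) - (y m : ℂ)))) *
    h (Function.extend i y x')

/-- The elementary creation operator for a tuple that need not consist of distinct labels. -/
def tupleCreation (ε : Sgn) (μ : ℂ) (i : Fin n → Fin N) (h : (Fin N → ℝ) → ℂ) :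
    (Fin (N + 1) → ℝ) → ℂ :=
  stepOp (chain ε i) fun x =>
    Complex.exp (Complex.I * μ * (x (newLabel N ε) : ℂ)) *
      iterIntegral n (fun m => x (chain ε i m.succ)) (fun m => x (chain ε i m.castSucc))
        (creationIntegrand μ i h fun j => x (shiftLabel ε j))

theorem tupleCreation_coe (ε : Sgn) (μ : ℂ) (i : Fin n ↪ Fin N) (h : (Fin N → ℝ) → ℂ) :
    tupleCreation ε μ i h = elemCreation ε μ i h := rfl

theorem tupleCreation_of_strictAnti {ε : Sgn} {i : Fin n → Fin N} {x : Fin (N + 1) → ℝ}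
    (hx : StrictAnti fun m => x (chain ε i m)) (μ : ℂ) (h : (Fin N → ℝ) → ℂ) :
    tupleCreation ε μ i h x = Complex.exp (Complex.I * μ * (x (newLabel N ε) : ℂ)) *
      iterIntegral n (fun m => x (chain ε i m.succ)) (fun m => x (chain ε i m.castSucc))
        (creationIntegrand μ i h fun j => x (shiftLabel ε j)) :=
  if_pos hx

theorem tupleCreation_of_not_strictAnti {ε : Sgn} {i : Fin n → Fin N} {x : Fin (N + 1) → ℝ}
    (hx : ¬ StrictAnti fun m => x (chain ε i m)) (μ : ℂ) (h : (Fin N → ℝ) → ℂ) :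
    tupleCreation ε μ i h x = 0 :=
  if_neg hx

theorem continuous_extend (i : Fin n → Fin N) (x' : Fin N → ℝ) :
    Continuous fun y : Fin n → ℝ => Function.extend i y x' := by
  classical
  refine continuous_pi fun j => ?_
  by_cases hj : ∃ m, i m = j
  · simp only [Function.extend_def, hj, dif_pos]
    exact continuous_apply _
  · simp only [Function.extend_apply' _ _ _ hj]
    exact continuous_const

theorem continuous_creationIntegrand (μ : ℂ) (i : Fin n → Fin N) {h : (Fin N → ℝ) → ℂ}
    (hh : Continuous h) (x' : Fin N → ℝ) : Continuous (creationIntegrand μ i h x') := by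
  refine Continuous.mul ?_ (hh.comp (continuous_extend i x'))
  fun_prop

theorem exchangePoint_tupleCreation_of_not (ε : Sgn) (μ : ℂ) (h : (Fin N → ℝ) → ℂ) {k : Fin N}
    {i : Fin n → Fin N} {x : Fin (N + 1) → ℝ}
    (hx : ¬ StrictAnti fun m => x (chain ε (extTuple ε k i) m)) {y : ℝ}
    (hlt : lowerLimit ε (x (newLabel N ε)) (x (shiftLabel ε k)) <
      upperLimit ε (x (newLabel N ε)) (x (shiftLabel ε k)))
    (hy : y ∈ Set.Icc (lowerLimit ε (x (newLabel N ε)) (x (shiftLabel ε k)))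
      (upperLimit ε (x (newLabel N ε)) (x (shiftLabel ε k)))) :
    tupleCreation ε μ i h (exchangePoint ε k x y) = 0 := by
  refine tupleCreation_of_not_strictAnti (fun hs => ?_) μ h
  by_cases hk : ∃ m, i m = k
  · obtain ⟨m, hm⟩ := hk
    exact not_strictAnti_exchangePoint ε hm hy hs
  · push Not at hk
    simp only [exchangePoint_chain ε hk] at hs
    exact hx ((strictAnti_extTuple_iff ε k i x).2 ⟨hlt, hs⟩)

theorem exchangePoint_tupleCreation (ε : Sgn) (μ : ℂ) (h : (Fin N → ℝ) → ℂ) {k : Fin N}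
    {i : Fin n → Fin N} {x : Fin (N + 1) → ℝ}
    (hx : StrictAnti fun m => x (chain ε (extTuple ε k i) m)) (y : ℝ) :
    Complex.exp (Complex.I * μ * ((x (newLabel N ε) : ℂ) - (y : ℂ))) *
        tupleCreation ε μ i h (exchangePoint ε k x y) =
      Complex.exp (Complex.I * μ * (x (newLabel N ε) : ℂ)) *
        iterIntegral n (fun m => x (chain ε (extTuple ε k i) (extEmb ε m.succ)))
          (fun m => x (chain ε (extTuple ε k i) (extEmb ε m.castSucc)))
          (fun ys => creationIntegrand μ (extTuple ε k i) h (fun j => x (shiftLabel ε j))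
            (extTuple ε y ys)) := by
  have hinj := injective_of_strictAnti ε _ x hx
  have hk : ∀ m, i m ≠ k := by
    intro m hm
    apply extEmb_ne_extPos ε m
    apply hinj
    simpa using hm
  have hs := ((strictAnti_extTuple_iff ε k i x).1 hx).2
  simp only [← exchangePoint_chain ε hk x y] at hs ⊢
  rw [tupleCreation_of_strictAnti hs, ← iterIntegral_const_mul, ← iterIntegral_const_mul,
    ← iterIntegral_const_mul]
  congr 1
  funext ys
  rw [creationIntegrand, creationIntegrand, extend_extTuple ε hinj,
    prod_extTuple ε (fun m => Complex.exp (Complex.I * μ *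
      ((x (shiftLabel ε (extTuple ε k i m)) : ℂ) - ((extTuple ε y ys m : ℝ) : ℂ))))]
  simp only [extTuple_extPos, extTuple_extEmb, exchangePoint_newLabel]
  have hprod : ∀ m, exchangePoint ε k x y (shiftLabel ε (i m)) = x (shiftLabel ε (i m)) := by
    intro m
    rw [exchangePoint_shiftLabel, if_neg (hk m)]
  -- Exponents are regrouped by `(x_new - y) + x_k = x_new + (x_k - y)`.
  simp only [hprod, ← mul_assoc, ← Complex.exp_add]
  congr 3
  ring

/-- On the closed interval the step function does not depend on `y`: either the integrand vanishes
throughout or it is a continuous iterated integral. This gives the integrability needed to exchange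
integrals with sums. -/
theorem continuousOn_tupleCreation_exchangePoint (ε : Sgn) (μ : ℂ) {h : (Fin N → ℝ) → ℂ}
    (hh : Continuous h) (k : Fin N) (i : Fin n → Fin N) (x : Fin (N + 1) → ℝ)
    (hlt : lowerLimit ε (x (newLabel N ε)) (x (shiftLabel ε k)) <
      upperLimit ε (x (newLabel N ε)) (x (shiftLabel ε k))) :
    ContinuousOn (fun y : ℝ => Complex.exp (Complex.I * μ * ((x (newLabel N ε) : ℂ) - (y : ℂ))) *
        tupleCreation ε μ i h (exchangePoint ε k x y))
      (Set.uIcc (lowerLimit ε (x (newLabel N ε)) (x (shiftLabel ε k)))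
        (upperLimit ε (x (newLabel N ε)) (x (shiftLabel ε k)))) := by
  rw [Set.uIcc_of_le hlt.le]
  by_cases hx : StrictAnti fun m => x (chain ε (extTuple ε k i) m)
  · simp only [exchangePoint_tupleCreation ε μ h hx]
    refine (continuous_const.mul (continuous_iterIntegral n _ _ ?_)).continuousOn
    exact (continuous_creationIntegrand μ _ hh _).comp (continuous_extTuple ε)
  · refine (continuousOn_const (c := (0 : ℂ))).congr fun y hy => ?_
    rw [exchangePoint_tupleCreation_of_not ε μ h hx hlt hy, mul_zero]

theorem tupleCreation_extTuple (ε : Sgn) (μ : ℂ) {h : (Fin N → ℝ) → ℂ}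
    (hh : Continuous h) (k : Fin N) (i : Fin n → Fin N) (x : Fin (N + 1) → ℝ) :
    tupleCreation ε μ (extTuple ε k i) h x =
      exchangeIntegral ε μ k (tupleCreation ε μ i h) x := by
  rw [exchangeIntegral]
  by_cases hx : StrictAnti fun m => x (chain ε (extTuple ε k i) m)
  · rw [if_pos ((strictAnti_extTuple_iff ε k i x).1 hx).1, tupleCreation_of_strictAnti hx,
      iterIntegral_extTuple ε k i x (continuous_creationIntegrand μ _ hh _),
      ← intervalIntegral.integral_const_mul]
    exact intervalIntegral.integral_congr fun y _ => (exchangePoint_tupleCreation ε μ h hx y).symm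
  · rw [tupleCreation_of_not_strictAnti hx]
    split_ifs with hlt
    · rw [intervalIntegral.integral_congr (g := fun _ => 0)]
      · simp
      · intro y hy
        rw [Set.uIcc_of_le hlt.le] at hy
        simp only [exchangePoint_tupleCreation_of_not ε μ h hx hlt hy, mul_zero]
    · rfl

/-- The sum of the elementary creation operators over all tuples of length `n`. -/
def levelCreation (n : ℕ) (ε : Sgn) (μ : ℂ) (h : (Fin N → ℝ) → ℂ) (x : Fin (N + 1) → ℝ) : ℂ :=
  ∑ i : Fin n → Fin N, tupleCreation ε μ i h x

/-- A strict chain forces distinct labels, so tuples with repetitions add zero. Over all tuples, the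
sum splits freely into a sum over the adjoined label and one over the shorter tuple. -/
theorem sum_elemCreation (n : ℕ) (ε : Sgn) (μ : ℂ) (h : (Fin N → ℝ) → ℂ)
    (x : Fin (N + 1) → ℝ) :
    ∑ i : Fin n ↪ Fin N, elemCreation ε μ i h x = levelCreation n ε μ h x := by
  refine Finset.sum_of_injOn (fun i : Fin n ↪ Fin N => (i : Fin n → Fin N))
    (DFunLike.coe_injective.injOn) (fun _ _ => Finset.mem_coe.2 (Finset.mem_univ _)) ?_
    fun i _ => rfl
  intro i _ hi
  refine tupleCreation_of_not_strictAnti (fun hs => hi ?_) μ h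
  exact ⟨⟨i, injective_of_strictAnti ε i x hs⟩, Finset.mem_coe.2 (Finset.mem_univ _), rfl⟩

theorem creation_eq_sum (γ : ℝ) (ε : Sgn) (μ : ℂ) (h : (Fin N → ℝ) → ℂ) :
    creation γ ε μ h = fun x =>
      ∑ n ∈ Finset.range (N + 1), (γ : ℂ) ^ n * levelCreation n ε μ h x := by
  funext x
  simp only [creation, sum_elemCreation]

theorem exchangeIntegral_sum {ι : Type*} (s : Finset ι) (ε : Sgn) (μ : ℂ) (k : Fin N) (c : ι → ℂ)
    (g : ι → (Fin (N + 1) → ℝ) → ℂ) (x : Fin (N + 1) → ℝ)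
    (hg : lowerLimit ε (x (newLabel N ε)) (x (shiftLabel ε k)) <
        upperLimit ε (x (newLabel N ε)) (x (shiftLabel ε k)) → ∀ i ∈ s,
      ContinuousOn (fun y : ℝ => Complex.exp (Complex.I * μ * ((x (newLabel N ε) : ℂ) - (y : ℂ))) *
          g i (exchangePoint ε k x y))
        (Set.uIcc (lowerLimit ε (x (newLabel N ε)) (x (shiftLabel ε k)))
          (upperLimit ε (x (newLabel N ε)) (x (shiftLabel ε k))))) :
    exchangeIntegral ε μ k (fun z => ∑ i ∈ s, c i * g i z) x =
      ∑ i ∈ s, c i * exchangeIntegral ε μ k (g i) x := by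
  simp only [exchangeIntegral]
  split_ifs with hlt
  · simp only [← intervalIntegral.integral_const_mul]
    rw [← intervalIntegral.integral_finsetSum]
    · refine intervalIntegral.integral_congr fun y _ => ?_
      simp only [Finset.mul_sum]
      exact Finset.sum_congr rfl fun i _ => by ring
    · exact fun i hi => (continuousOn_const.mul (hg hlt i hi)).intervalIntegrable
  · simp

theorem exchangeIntegral_levelCreation (n : ℕ) (ε : Sgn) (μ : ℂ) {h : (Fin N → ℝ) → ℂ}
    (hh : Continuous h) (k : Fin N) (x : Fin (N + 1) → ℝ) :
    exchangeIntegral ε μ k (levelCreation n ε μ h) x =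
      ∑ i : Fin n → Fin N, tupleCreation ε μ (extTuple ε k i) h x := by
  have h1 := exchangeIntegral_sum Finset.univ ε μ k (fun _ => 1)
    (fun i : Fin n → Fin N => tupleCreation ε μ i h) x fun hlt i _ =>
      continuousOn_tupleCreation_exchangePoint ε μ hh k i x hlt
  simp only [one_mul] at h1
  simp only [tupleCreation_extTuple ε μ hh]
  exact h1

theorem levelCreation_succ (n : ℕ) (ε : Sgn) (μ : ℂ) {h : (Fin N → ℝ) → ℂ}
    (hh : Continuous h) (x : Fin (N + 1) → ℝ) :
    levelCreation (n + 1) ε μ h x = ∑ k, exchangeIntegral ε μ k (levelCreation n ε μ h) x := by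
  simp only [exchangeIntegral_levelCreation n ε μ hh]
  exact sum_extTuple ε fun i => tupleCreation ε μ i h x

theorem levelCreation_zero (ε : Sgn) (μ : ℂ) (h : (Fin N → ℝ) → ℂ) (x : Fin (N + 1) → ℝ) :
    levelCreation 0 ε μ h x = Complex.exp (Complex.I * μ * (x (newLabel N ε) : ℂ)) *
      h (fun k => x (shiftLabel ε k)) := by
  rw [levelCreation, Fintype.sum_unique, ← emptyCreation_apply, emptyCreation,
    ← tupleCreation_coe]
  congr 1

theorem levelCreation_of_lt (hn : N < n) (ε : Sgn) (μ : ℂ) (h : (Fin N → ℝ) → ℂ)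
    (x : Fin (N + 1) → ℝ) : levelCreation n ε μ h x = 0 := by
  refine Finset.sum_eq_zero fun i _ => tupleCreation_of_not_strictAnti (fun hs => ?_) μ h
  have hc := Fintype.card_le_of_injective i (injective_of_strictAnti ε i x hs)
  simp only [Fintype.card_fin] at hc
  omega

theorem creation_eq (γ : ℝ) (ε : Sgn) (μ : ℂ) {h : (Fin N → ℝ) → ℂ} (hh : Continuous h)
    (x : Fin (N + 1) → ℝ) :
    creation γ ε μ h x = Complex.exp (Complex.I * μ * (x (newLabel N ε) : ℂ)) *
        h (fun k => x (shiftLabel ε k)) +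
      γ * ∑ k, exchangeIntegral ε μ k (creation γ ε μ h) x := by
  have h1 : ∀ k, exchangeIntegral ε μ k (creation γ ε μ h) x =
      ∑ n ∈ Finset.range (N + 1), (γ : ℂ) ^ n *
        exchangeIntegral ε μ k (levelCreation n ε μ h) x := by
    intro k
    rw [creation_eq_sum]
    refine exchangeIntegral_sum _ ε μ k _ _ x fun hlt n _ => ?_
    simp only [levelCreation, Finset.mul_sum]
    exact continuousOn_finsetSum _ fun i _ =>
      continuousOn_tupleCreation_exchangePoint ε μ hh k i x hlt
  simp only [h1]
  rw [Finset.sum_comm]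
  simp only [← Finset.mul_sum, ← levelCreation_succ _ ε μ hh]
  have h2 : creation γ ε μ h x =
      ∑ n ∈ Finset.range (N + 1), (γ : ℂ) ^ n * levelCreation n ε μ h x := by
    rw [creation_eq_sum]
  -- The exchange raises every level by one. Level `0` is the inhomogeneous term, and the surplus
  -- level `N + 1` vanishes because there are only `N` labels.
  rw [h2, Finset.sum_range_succ', Finset.sum_range_succ _ N,
    levelCreation_of_lt (Nat.lt_succ_self N), levelCreation_zero]
  simp only [pow_succ, pow_zero, one_mul, mul_zero, add_zero, Finset.mul_sum]
  rw [add_comm]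
  congr 1
  exact Finset.sum_congr rfl fun n _ => by ring

/-- The integral recursion determines its solution. -/
theorem eq_of_exchangeIntegral_recursion (γ : ℝ) (ε : Sgn) (μ : ℂ)
    {A F G : (Fin (N + 1) → ℝ) → ℂ}
    (hF : ∀ x, F x = A x + γ * ∑ k, exchangeIntegral ε μ k F x)
    (hG : ∀ x, G x = A x + γ * ∑ k, exchangeIntegral ε μ k G x) : F = G := by
  classical
  -- `S x` collects the labels with a nonempty exchange interval; its cardinality is the induction
  -- measure.
  let S : (Fin (N + 1) → ℝ) → Finset (Fin N) := fun x => Finset.univ.filter fun k =>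
    lowerLimit ε (x (newLabel N ε)) (x (shiftLabel ε k)) <
      upperLimit ε (x (newLabel N ε)) (x (shiftLabel ε k))
  have key : ∀ m x, (S x).card < m → F x = G x := by
    intro m
    induction m with
    | zero => simp
    | succ m ih =>
      intro x hx
      rw [hF, hG]
      congr 2
      refine Finset.sum_congr rfl fun k _ => ?_
      simp only [exchangeIntegral]
      split_ifs with hlt
      · refine intervalIntegral.integral_congr fun y hy => ?_
        rw [Set.uIcc_of_le hlt.le] at hy
        refine congrArg
          (fun t => Complex.exp (Complex.I * μ * ((x (newLabel N ε) : ℂ) - (y : ℂ))) * t) ?_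
        refine ih _ (lt_of_lt_of_le (Finset.card_lt_card ?_) (Nat.lt_succ_iff.1 hx))
        -- No label enters, by transitivity through `x_k`. The label `k` leaves, since its
        -- coordinate `y` does not lie beyond the new position `x_k` of the added particle.
        refine Finset.ssubset_iff_subset_ne.2 ⟨fun j hj => ?_, fun he => ?_⟩
        · simp only [S, Finset.mem_filter, Finset.mem_univ, true_and, exchangePoint_newLabel,
            exchangePoint_shiftLabel] at hj ⊢
          split_ifs at hj with hjk
          · rwa [hjk]
          · cases ε
            · exact lt_trans hlt hj
            · exact lt_trans hj hlt
        · have hk : k ∈ S x := by simpa [S] using hlt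
          rw [← he] at hk
          simp only [S, Finset.mem_filter, Finset.mem_univ, true_and, exchangePoint_newLabel,
            exchangePoint_shiftLabel, if_true] at hk
          cases ε
          · exact absurd hy.2 (not_le.2 hk)
          · exact absurd hy.1 (not_le.2 hk)
      · rfl
  exact funext fun x => key _ x (Nat.lt_succ_self _)

/-- `P^γ_{(N+1)} ê^ε_{μ;∅} = b^ε_μ P^γ_{(N)}`. -/
theorem propagation_emptyCreation (γ : ℝ) (ε : Sgn) (μ : ℂ) (f : smoothFun N) :
    propagation γ (emptyCreation ε μ f.1) = creation γ ε μ (propagation γ f.1) :=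
  eq_of_exchangeIntegral_recursion γ ε μ (propagation_emptyCreation_eq γ ε μ f)
    (creation_eq γ ε μ (continuous_propagation γ f))

theorem emptyCreationSmooth_add (ε : Sgn) (μ : ℂ) (f g : smoothFun N) :
    emptyCreationSmooth ε μ (f + g) = emptyCreationSmooth ε μ f + emptyCreationSmooth ε μ g := by
  ext x
  change emptyCreation ε μ (f.1 + g.1) x = emptyCreation ε μ f.1 x + emptyCreation ε μ g.1 x
  simp only [emptyCreation_apply, Pi.add_apply, mul_add]

theorem emptyCreationSmooth_smul (ε : Sgn) (μ : ℂ) (c : ℂ) (f : smoothFun N) :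
    emptyCreationSmooth ε μ (c • f) = c • emptyCreationSmooth ε μ f := by
  ext x
  change emptyCreation ε μ (c • f.1) x = c * emptyCreation ε μ f.1 x
  simp only [emptyCreation_apply, Pi.smul_apply, smul_eq_mul, mul_left_comm]

/-- `P^γ_{(N+1)} ê^ε_{μ;∅}` as a linear map. -/
def propagatedCreation (γ : ℝ) (ε : Sgn) (μ : ℂ) : smoothFun N →ₗ[ℂ] cbFun (N + 1) where
  toFun f := ⟨propagation γ (emptyCreationSmooth ε μ f).1, propagation_mem_cbFun γ _⟩
  map_add' f g := Subtype.ext <| by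
    simp only [emptyCreationSmooth_add, propagation_add]
    rfl
  map_smul' c f := Subtype.ext <| by
    simp only [emptyCreationSmooth_smul, propagation_smul]
    rfl

end Creation

end QNLS

end

theorem mainTheorem1 (γ : ℝ) (N : ℕ) (ε : Sgn) (μ : ℂ) :
    (∀ f ∈ smoothFun N, emptyCreation ε μ f ∈ smoothFun (N + 1)) ∧
    (∀ f ∈ smoothFun N, propagation γ f ∈ cbFun N) ∧
    ∃ T : smoothFun N →ₗ[ℂ] cbFun (N + 1), ∀ f : smoothFun N,
      (T f : (Fin (N + 1) → ℝ) → ℂ) =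
          propagation γ (emptyCreation ε μ (f : (Fin N → ℝ) → ℂ)) ∧
      (T f : (Fin (N + 1) → ℝ) → ℂ) =
          creation γ ε μ (propagation γ (f : (Fin N → ℝ) → ℂ)) :=
  ⟨fun f hf => (emptyCreationSmooth ε μ ⟨f, hf⟩).2,
    fun f hf => propagation_mem_cbFun γ ⟨f, hf⟩,
    propagatedCreation γ ε μ, fun f => ⟨rfl, propagation_emptyCreation γ ε μ f⟩⟩
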